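/- Let $S$ be a closed connected oriented smooth surface with universal covering $p:X\to S$ and group of deck transformations $\Gamma\cong\pi_1(S)$, and let $\rho_1,\rho_2:\Gamma\to SL(2,\mathbb R)$ be representations. Let $\omega$ be the standard volume form on $\mathbb R^2$. Let $E_i=(X\times\mathbb R^2)/\Gamma$ be the flat plane bundle of $\rho_i$ over $S$, oriented by the parallel form $\omega$, and let $E=E_1\otimes E_2=(X\times(\mathbb R^2\otimes\mathbb R^2))/\Gamma$ be the flat bundle of $\rho_1\otimes\rho_2$, with the parallel symmetric bilinear form $Q=\omega\otimes\omega$ of signature $(2,2)$. A sub-bundle $F\subset E$ is called time-like (space-like) if $Q(v,v)>0$ (respectively $Q(v,v)<0$) for all non-zero $v\in F$. To an oriented real plane bundle $F$ over $S$ belong two oriented circle bundles: the bundle of rays $S(F)=(F\setminus 0)/\mathbb R_{>0}$, whose Euler number is the Euler number of $F$ as an oriented vector bundle, and the bundle of lines $P(F)=(F\setminus 0)/\mathbb R^{\times}$, whose Euler number is twice as large. The Euler number of $P(E_i)$ is the Euler number of the representation $\rho_i$. The Euler number of such a circle bundle is the sum of the indices of a section with finitely many singularities. Let $e(F)$ denote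 the Euler number of $F$ in one of these two normalizations, the same for all plane bundles below, and put $e_i=e(E_i)$. **Proposition.** The bundle $E$ splits as a $Q$-orthogonal direct sum $E=F_1\oplus F_2$ of two smooth real sub-bundles of rank 2 such that $F_1$ is time-like, $F_2$ is space-like and, in each of the two normalizations and for suitable orientations of $F_1$ and $F_2$, $$e(F_1)=|e_1-e_2|,\qquad e(F_2)=|e_1+e_2|.$$ Moreover, for $i=1,2$ let $H_i$ be any smooth $\rho_i$-equivariant map from $X$ to the hyperbolic plane $SL(2,\mathbb R)/SO(2)$ (the space of positive definite symmetric $2\times2$ matrices of determinant $1$), for instance a harmonic one. Regard $H_i$ as a metric on $E_i$, and let $E_1^{\mathbb C}=L\oplus L^{-1}$ and $E_2^{\mathbb C}=N\oplus N^{-1}$ be the splittings into the isotropic lines of the complex-bilinear extension of $H_i$, where $L$ and $N$ are given by $H_iu=\mathrm i\,\Omega u$ and $L^{-1}$, $N^{-1}$ by $H_iu=-\mathrm i\,\Omega u$, with $\Omega$ the matrix of $\omega$, $\omega(v,w)=v^{T}\Omega w$. Then all of the above holds when $F_1$ is the real part of $LN^{-1}\oplus L^{-1}N$ and $F_2$ is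 the real part of $LN\oplus L^{-1}N^{-1}$. -/

import Mathlib

open Set Topology
open scoped Manifold ContDiff TensorProduct MatrixGroups

noncomputable section

/-! ### Oriented surfaces -/

/-- The charts of the surface `S` form an oriented atlas: all transition maps have positive
Jacobian determinant. -/
def IsOrientedAtlas (S : Type*) [TopologicalSpace S] [ChartedSpace ℂ S] : Prop :=
  ∀ e ∈ atlas ℂ S, ∀ e' ∈ atlas ℂ S, ∀ w ∈ (e.symm.trans e').source,
    0 < LinearMap.det (fderiv ℝ (e.symm.trans e') w : ℂ →ₗ[ℝ] ℂ)

/-! ### Flat bundles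

`Γ` is the group of deck transformations of the universal covering `p : X → S`, that is, the
fundamental group of `S`. A representation `r` of `Γ` on `V` gives the flat vector bundle
`(X × V) / Γ` over `S`. -/

section FlatBundle

variable (X : Type*) {Γ V : Type*} [Group Γ] [MulAction Γ X] [AddCommGroup V] [Module ℝ V]
  (r : Representation ℝ Γ V)

/-- The orbit relation of the diagonal action `g • (x, v) = (g • x, r g v)` on `X × V`. -/
def flatSetoid : Setoid (X × V) where
  r a b := ∃ g : Γ, g • a.1 = b.1 ∧ r g a.2 = b.2
  iseqv := by
    refine ⟨fun a => ⟨1, by simp⟩, ?_, ?_⟩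
    · rintro a b ⟨g, h1, h2⟩
      refine ⟨g⁻¹, by rw [← h1, inv_smul_smul], ?_⟩
      rw [← h2, ← Module.End.mul_apply, ← map_mul]
      simp
    · rintro a b c ⟨g, h1, h2⟩ ⟨k, h3, h4⟩
      refine ⟨k * g, by rw [mul_smul, h1, h3], ?_⟩
      rw [map_mul, Module.End.mul_apply, h2, h4]

/-- The total space `(X × V) / Γ` of the flat vector bundle with monodromy `r`. -/
def FlatBundle : Type _ := Quotient (flatSetoid X r)

variable {X r}

/-- The class of `(x, v)` in the total space. For fixed `x` this identifies `V` with the fibre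
over the image of `x` in `S`. -/
def FlatBundle.mk (x : X) (v : V) : FlatBundle X r :=
  Quotient.mk (flatSetoid X r) (x, v)

/-- The part of a subset of the total space lying in the fibre over the image of `x`, read in
`V`. -/
def fiberAt (F : Set (FlatBundle X r)) (x : X) : Set V :=
  {v | FlatBundle.mk x v ∈ F}

/-- `F` is a smooth real vector sub-bundle of rank `k`: locally its fibres are spanned by `k`
smooth, pointwise linearly independent sections. (Smoothness of `V`-valued maps is tested on
linear functionals.) -/
def IsSubbundle [TopologicalSpace X] [ChartedSpace ℂ X] (F : Set (FlatBundle X r)) (k : ℕ) :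
    Prop :=
  ∀ x₀ : X, ∃ U : Set X, IsOpen U ∧ x₀ ∈ U ∧ ∃ f : Fin k → X → V,
    (∀ i, ∀ l : Module.Dual ℝ V, ContMDiffOn 𝓘(ℝ, ℂ) 𝓘(ℝ, ℝ) ∞ (fun x => l (f i x)) U) ∧
    ∀ x ∈ U, LinearIndependent ℝ (fun i => f i x) ∧
      fiberAt F x = (Submodule.span ℝ (range fun i => f i x) : Set V)

/-- An orientation of a rank 2 sub-bundle `F`, given by an area form: a continuous `Γ`-invariant
family of alternating bilinear forms that is non-degenerate on the fibres of `F`. A basis `v, w`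
of a fibre is positive if `A x v w > 0`. -/
structure IsOrientation [TopologicalSpace X] (F : Set (FlatBundle X r))
    (A : X → LinearMap.BilinForm ℝ V) : Prop where
  alt : ∀ x, (A x).IsAlt
  equivariant : ∀ (g : Γ) (x : X) (v w : V), A (g • x) (r g v) (r g w) = A x v w
  continuous : ∀ v w : V, Continuous fun x => A x v w
  nondegenerate : ∀ x, ∀ v ∈ fiberAt F x, ∀ w ∈ fiberAt F x,
    LinearIndependent ℝ ![v, w] → A x v w ≠ 0

/-! ### Euler numbers of oriented plane bundles

The Euler number of an oriented circle bundle over a closed oriented surface is the sum of the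
indices of a section with finitely many singularities. To a plane bundle `F` belong two circle
bundles: the bundle of rays `S(F) = (F ∖ 0) / ℝ_{>0}`, whose Euler number is the Euler number of
`F` as an oriented vector bundle, and the bundle of lines `P(F) = (F ∖ 0) / ℝ^×`. For the flat
plane bundle of `ρ : Γ → SL(2, ℝ)`, the latter is the flat `PSL(2, ℝ)`-bundle with fibre `ℝP¹`,
whose Euler number is the Euler number of the representation `ρ`. -/

/-- The two circle bundles of a plane bundle: rays or lines. -/
inductive CircleKind
  | rays
  | lines

/-- The scalars which are divided out. -/
def CircleKind.scalars : CircleKind → Set ℝ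
  | .rays => Ioi 0
  | .lines => {0}ᶜ

/-- The angle after which a rotating ray, respectively line, returns to its place for the first
time. -/
def CircleKind.period : CircleKind → ℝ
  | .rays => 2 * Real.pi
  | .lines => Real.pi

/-- `C` is a continuous section over `S ∖ Z` of the bundle of rays, respectively lines, of `F`.
A section is given as the set of all vectors in the chosen rays (lines without origin). -/
def IsCircleSection {S : Type*} [TopologicalSpace X] (p : X → S) (κ : CircleKind)
    (F : Set (FlatBundle X r)) (Z : Set S) (C : Set (FlatBundle X r)) : Prop :=
  ∀ x₀ : X, p x₀ ∉ Z → ∃ U : Set X, IsOpen U ∧ x₀ ∈ U ∧ ∃ u : X → V,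
    (∀ l : Module.Dual ℝ V, ContinuousOn (fun x => l (u x)) U) ∧
    ∀ x ∈ U, u x ≠ 0 ∧ u x ∈ fiberAt F x ∧
      fiberAt C x = {v | ∃ c ∈ κ.scalars, v = c • u x}

/-- The section `C` of rays or lines of `F`, oriented by `A`, has index `n` at the point `p x`.
On a small coordinate disc around `p x`, lifted to `X` by `σ`, and in a positive frame `f₁, f₂`
of `F` over this disc, the ray (line) turns `n` times while the base point runs once through a
small positively oriented circle around `p x`. -/
def HasIndexAt {S : Type*} [TopologicalSpace S] [ChartedSpace ℂ S] [TopologicalSpace X]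
    (p : X → S) (κ : CircleKind) (F : Set (FlatBundle X r)) (A : X → LinearMap.BilinForm ℝ V)
    (C : Set (FlatBundle X r)) (x : X) (n : ℤ) : Prop :=
  let e := chartAt ℂ (p x)
  let w₀ : ℂ := e (p x)
  ∃ (R : ℝ) (σ : ℂ → X) (f₁ f₂ : ℂ → V), 0 < R ∧
    Metric.ball w₀ R ⊆ e.target ∧
    σ w₀ = x ∧ ContinuousOn σ (Metric.ball w₀ R) ∧
    (∀ w ∈ Metric.ball w₀ R, p (σ w) = e.symm w) ∧
    (∀ l : Module.Dual ℝ V, ContinuousOn (fun w => l (f₁ w)) (Metric.ball w₀ R)) ∧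
    (∀ l : Module.Dual ℝ V, ContinuousOn (fun w => l (f₂ w)) (Metric.ball w₀ R)) ∧
    (∀ w ∈ Metric.ball w₀ R, f₁ w ∈ fiberAt F (σ w) ∧ f₂ w ∈ fiberAt F (σ w) ∧
      0 < A (σ w) (f₁ w) (f₂ w)) ∧
    ∀ ε ∈ Ioo (0 : ℝ) R, ∃ θ : ℝ → ℝ, Continuous θ ∧
      (∀ t ∈ Icc (0 : ℝ) (2 * Real.pi),
        Real.cos (θ t) • f₁ (circleMap w₀ ε t) + Real.sin (θ t) • f₂ (circleMap w₀ ε t) ∈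
          fiberAt C (σ (circleMap w₀ ε t))) ∧
      θ (2 * Real.pi) - θ 0 = n * κ.period

/-- The circle bundle (rays or lines) of the plane bundle `F`, oriented by `A`, over the closed
oriented surface `S` has Euler number `n`: there is a section with finitely many singularities
whose indices add up to `n`. -/
def HasEulerNumber {S : Type*} [TopologicalSpace S] [ChartedSpace ℂ S] [TopologicalSpace X]
    (p : X → S) (κ : CircleKind) (F : Set (FlatBundle X r)) (A : X → LinearMap.BilinForm ℝ V)
    (n : ℤ) : Prop :=
  ∃ (Z : Finset S) (C : Set (FlatBundle X r)) (ind : S → ℤ),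
    IsCircleSection p κ F (Z : Set S) C ∧
    (∀ x : X, p x ∈ Z → HasIndexAt p κ F A C x (ind (p x))) ∧
    ∑ z ∈ Z, ind z = n

end FlatBundle

/-! ### The tensor product of two representations in `SL(2, ℝ)` -/

/-- The action of `Γ` on `ℝ²` through `ρ`. -/
def stdRep {Γ : Type*} [Group Γ] (ρ : Γ →* SL(2, ℝ)) : Representation ℝ Γ (Fin 2 → ℝ) where
  toFun g := Matrix.toLin' (ρ g : Matrix (Fin 2) (Fin 2) ℝ)
  map_one' := by simp [Module.End.one_eq_id]
  map_mul' g h := by simp [Matrix.toLin'_mul, Module.End.mul_eq_comp]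

/-- The representation `ρ₁ ⊗ ρ₂` on `ℝ² ⊗ ℝ²`. -/
abbrev tensorRep {Γ : Type*} [Group Γ] (ρ₁ ρ₂ : Γ →* SL(2, ℝ)) :
    Representation ℝ Γ ((Fin 2 → ℝ) ⊗[ℝ] (Fin 2 → ℝ)) :=
  (stdRep ρ₁).tprod (stdRep ρ₂)

/-- The matrix of the standard volume form `ω(v, w) = v₀ w₁ - v₁ w₀`. -/
def volMatrix : Matrix (Fin 2) (Fin 2) ℝ := !![0, 1; -1, 0]

/-- The standard volume form `ω(v, w) = v₀ w₁ - v₁ w₀` on `ℝ²`. -/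
def volForm : LinearMap.BilinForm ℝ (Fin 2 → ℝ) := Matrix.toBilin' volMatrix

/-- The bilinear form `Q = ω ⊗ ω` on `ℝ² ⊗ ℝ²`. -/
def formQ : LinearMap.BilinForm ℝ ((Fin 2 → ℝ) ⊗[ℝ] (Fin 2 → ℝ)) :=
  LinearMap.BilinForm.tmul volForm volForm

/-- `F₁, F₂` is a `Q`-orthogonal splitting of `E` into a time-like and a space-like plane bundle
with the Euler numbers `|e₁ - e₂|` and `|e₁ + e₂|` for suitable orientations. Here `E₁`, `E₂` are
the whole flat bundles of `ρ₁`, `ρ₂`, oriented by the parallel volume form. -/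
structure IsEulerSplitting {S X Γ : Type*} [TopologicalSpace S] [ChartedSpace ℂ S]
    [TopologicalSpace X] [ChartedSpace ℂ X] [Group Γ] [MulAction Γ X] (p : X → S)
    (ρ₁ ρ₂ : Γ →* SL(2, ℝ)) (F₁ F₂ : Set (FlatBundle X (tensorRep ρ₁ ρ₂))) : Prop where
  subbundle₁ : IsSubbundle F₁ 2
  subbundle₂ : IsSubbundle F₂ 2
  directSum : ∀ x v, ∃! q : ((Fin 2 → ℝ) ⊗[ℝ] (Fin 2 → ℝ)) × ((Fin 2 → ℝ) ⊗[ℝ] (Fin 2 → ℝ)),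
    q.1 ∈ fiberAt F₁ x ∧ q.2 ∈ fiberAt F₂ x ∧ q.1 + q.2 = v
  orthogonal : ∀ x, ∀ v ∈ fiberAt F₁ x, ∀ w ∈ fiberAt F₂ x, formQ v w = 0
  timelike : ∀ x, ∀ v ∈ fiberAt F₁ x, v ≠ 0 → 0 < formQ v v
  spacelike : ∀ x, ∀ v ∈ fiberAt F₂ x, v ≠ 0 → formQ v v < 0
  euler : ∀ (κ : CircleKind) (e₁ e₂ : ℤ),
    HasEulerNumber p κ (univ : Set (FlatBundle X (stdRep ρ₁))) (fun _ => volForm) e₁ →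
    HasEulerNumber p κ (univ : Set (FlatBundle X (stdRep ρ₂))) (fun _ => volForm) e₂ →
    (∃ A₁, IsOrientation F₁ A₁ ∧ HasEulerNumber p κ F₁ A₁ |e₁ - e₂|) ∧
    (∃ A₂, IsOrientation F₂ A₂ ∧ HasEulerNumber p κ F₂ A₂ |e₁ + e₂|)

/-! ### The sub-bundles obtained from equivariant maps to the hyperbolic plane -/

/-- A smooth `ρ`-equivariant map from `X` to the hyperbolic plane `SL(2, ℝ) / SO(2)`, the space of
positive definite symmetric matrices of determinant one; in other words, a smooth metric on the
flat plane bundle of `ρ` with area form `ω`. -/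
structure EquivariantMetric (X : Type*) {Γ : Type*} [TopologicalSpace X] [ChartedSpace ℂ X]
    [Group Γ] [MulAction Γ X] (ρ : Γ →* SL(2, ℝ)) where
  metric : X → Matrix (Fin 2) (Fin 2) ℝ
  smooth : ∀ i j, ContMDiff 𝓘(ℝ, ℂ) 𝓘(ℝ, ℝ) ∞ fun x => metric x i j
  posDef : ∀ x, (metric x).PosDef
  det_eq_one : ∀ x, (metric x).det = 1
  equivariant : ∀ (g : Γ) (x : X),
    (ρ g : Matrix (Fin 2) (Fin 2) ℝ).transpose * metric (g • x) * (ρ g : Matrix _ _ ℝ) = metric x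

/-- For `c = i` and `c = -i`: the two isotropic lines `L` and `L⁻¹` in `ℂ²` of the
complex-bilinear extension of the metric `H`, the solutions `u` of `H u = c Ω u`, where `Ω` is
the matrix of the volume form. -/
def isotropicLine (H : Matrix (Fin 2) (Fin 2) ℝ) (c : ℂ) : Submodule ℂ (Fin 2 → ℂ) :=
  LinearMap.ker (Matrix.toLin' (H.map Complex.ofReal) -
    c • Matrix.toLin' (volMatrix.map Complex.ofReal))

/-- The inclusion of `ℝ²` in `ℂ²`. -/
def complexifyVec : (Fin 2 → ℝ) →ₗ[ℝ] (Fin 2 → ℂ) :=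
  Complex.ofRealLI.toLinearMap.compLeft (Fin 2)

/-- The inclusion of `ℝ² ⊗ ℝ²` in its complexification `ℂ² ⊗ ℂ²`. -/
def complexify : (Fin 2 → ℝ) ⊗[ℝ] (Fin 2 → ℝ) →ₗ[ℝ] (Fin 2 → ℂ) ⊗[ℂ] (Fin 2 → ℂ) :=
  TensorProduct.lift (LinearMap.mk₂ ℝ (fun v w => complexifyVec v ⊗ₜ[ℂ] complexifyVec w)
    (fun v v' w => by rw [map_add, TensorProduct.add_tmul])
    (fun a v w => by rw [map_smul, TensorProduct.smul_tmul'])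
    (fun v w w' => by rw [map_add, TensorProduct.tmul_add])
    (fun a v w => by rw [map_smul, TensorProduct.tmul_smul]))

section RealParts

variable {X Γ : Type*} [TopologicalSpace X] [ChartedSpace ℂ X] [Group Γ] [MulAction Γ X]
  {ρ₁ ρ₂ : Γ →* SL(2, ℝ)} (H₁ : EquivariantMetric X ρ₁) (H₂ : EquivariantMetric X ρ₂)

/-- The tensor product of two of the line bundles `L^{±1}` (of `ρ₁`) and `N^{±1}` (of `ρ₂`) at
`x`; `c`, `d` are `i` or `-i`. -/
def tensorLine (c d : ℂ) (x : X) : Submodule ℂ ((Fin 2 → ℂ) ⊗[ℂ] (Fin 2 → ℂ)) :=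
  Submodule.map₂ (TensorProduct.mk ℂ _ _) (isotropicLine (H₁.metric x) c)
    (isotropicLine (H₂.metric x) d)

/-- The real part of `L N⁻¹ ⊕ L⁻¹ N`. -/
def realPart₁ : Set (FlatBundle X (tensorRep ρ₁ ρ₂)) :=
  {ξ | ∃ x v, ξ = FlatBundle.mk x v ∧ complexify v ∈
    tensorLine H₁ H₂ Complex.I (-Complex.I) x ⊔ tensorLine H₁ H₂ (-Complex.I) Complex.I x}

/-- The real part of `L N ⊕ L⁻¹ N⁻¹`. -/
def realPart₂ : Set (FlatBundle X (tensorRep ρ₁ ρ₂)) :=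
  {ξ | ∃ x v, ξ = FlatBundle.mk x v ∧ complexify v ∈
    tensorLine H₁ H₂ Complex.I Complex.I x ⊔ tensorLine H₁ H₂ (-Complex.I) (-Complex.I) x}

end RealParts

end

noncomputable section

/-! ### Linear algebra of `ℝ² ⊗ ℝ²` with two complex structures -/

/-! An equivariant metric turns each fibre into a complex line: J = Ω⁻¹H satisfies J² = -1,
preserves ω, has ω(v, Jv) > 0 and commutes with the deck group. So J₁ ⊗ J₂ is an equivariant
involution preserving Q. Its eigenspaces for s = 1 and s = -1 are Q-orthogonal planes, each spanned
by the projections (1 + s J₁ ⊗ J₂)/2 of v ⊗ w and J₁v ⊗ w for any non-zero v, w, and sQ is positive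
definite on them (`formQ_self_pos`). Over ℂ, the isotropic lines are the eigenlines of J for ±i, so
LN⁻¹ ⊕ L⁻¹N belongs to the eigenvalue i(-i) = 1 and LN ⊕ L⁻¹N⁻¹ to i² = -1 (`complexify_mem_iff`).

For the Euler numbers, take sections of the circle bundles of E₁ and E₂ with finitely many
singularities, multiply them and project to the eigenbundle. If the factors turn by φ₁ in the frame
v, J₁v and by φ₂ in w, J₂w, the product turns by φ₁ - sφ₂ in the frame above (`twistProj_rotate`).
Hence its indices are n₁ - s n₂ (`hasIndexAt_tensorSection`) and the Euler number is e₁ - s e₂;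
reversing the orientation if necessary gives the absolute value. Rays and lines are treated alike.
Indices are defined with arbitrary positive frames, so `HasIndexAt.hasComplexIndexAt` first passes
to a frame v, Jv; where only one factor is singular, the other has index 0 (`hasIndexAt_zero`).

Equivariant metrics exist because positive definite forms can be added: cut-off standard metrics on
evenly covered pieces are summed and normalized (`nonempty_equivariantMetric`). -/

lemma volForm_apply (v w : Fin 2 → ℝ) : volForm v w = v 0 * w 1 - v 1 * w 0 := by
  simp [volForm, volMatrix, Matrix.toBilin'_apply, Fin.sum_univ_two]
  ring

lemma volForm_isAlt : volForm.IsAlt := fun v => by rw [volForm_apply]; ring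

lemma volForm_self (v : Fin 2 → ℝ) : volForm v v = 0 := volForm_isAlt v

lemma volForm_swap (v w : Fin 2 → ℝ) : volForm v w = -volForm w v := by
  simp only [volForm_apply]; ring

/-- The linear relation between three vectors in the plane. -/
lemma volForm_smul_relation (u v w : Fin 2 → ℝ) :
    volForm v w • u = volForm u w • v + volForm v u • w := by
  ext i; fin_cases i <;> simp [volForm_apply] <;> ring

lemma stdRep_apply {Γ : Type*} [Group Γ] (ρ : Γ →* SL(2, ℝ)) (g : Γ) (v : Fin 2 → ℝ) :
    stdRep ρ g v = (ρ g : Matrix (Fin 2) (Fin 2) ℝ).mulVec v := rfl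

lemma volForm_stdRep {Γ : Type*} [Group Γ] (ρ : Γ →* SL(2, ℝ)) (g : Γ) (v w : Fin 2 → ℝ) :
    volForm (stdRep ρ g v) (stdRep ρ g w) = volForm v w := by
  have h := (ρ g).det_coe
  rw [Matrix.det_fin_two] at h
  simp only [volForm_apply, stdRep_apply, Matrix.mulVec, dotProduct, Fin.sum_univ_two]
  linear_combination (v 0 * w 1 - v 1 * w 0) * h

/-- A complex structure on the plane which is compatible with the volume form. -/
structure IsCompatible (J : (Fin 2 → ℝ) →ₗ[ℝ] (Fin 2 → ℝ)) : Prop where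
  sq : ∀ v, J (J v) = -v
  volForm_map : ∀ v w, volForm (J v) (J w) = volForm v w
  pos : ∀ v, v ≠ 0 → 0 < volForm v (J v)

namespace IsCompatible

variable {J : (Fin 2 → ℝ) →ₗ[ℝ] (Fin 2 → ℝ)}

/-- Cramer's rule in the basis v, Jv, whose determinant ω(v, Jv) is positive. -/
lemma exists_coord (h : IsCompatible J) {v : Fin 2 → ℝ} (hv : v ≠ 0) (u : Fin 2 → ℝ) :
    u = (volForm u (J v) / volForm v (J v)) • v + (volForm v u / volForm v (J v)) • J v := by
  have h0 := (h.pos v hv).ne'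
  have := volForm_smul_relation u v (J v)
  rw [div_eq_inv_mul, div_eq_inv_mul, mul_smul, mul_smul, ← smul_add, ← this, smul_smul,
    inv_mul_cancel₀ h0, one_smul]

end IsCompatible

variable (J₁ J₂ : (Fin 2 → ℝ) →ₗ[ℝ] (Fin 2 → ℝ))

/-- The projection `(1 + s J₁ ⊗ J₂) / 2`. -/
def twistProj (s : ℝ) :
    (Fin 2 → ℝ) ⊗[ℝ] (Fin 2 → ℝ) →ₗ[ℝ] (Fin 2 → ℝ) ⊗[ℝ] (Fin 2 → ℝ) :=
  (2⁻¹ : ℝ) • (LinearMap.id + s • TensorProduct.map J₁ J₂)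

/-- The alternating form `ω(·, J₁ ·) ⊗ ω`. -/
def twistForm : LinearMap.BilinForm ℝ ((Fin 2 → ℝ) ⊗[ℝ] (Fin 2 → ℝ)) :=
  LinearMap.BilinForm.tmul (volForm.compl₂ J₁) volForm

variable {J₁ J₂} {s : ℝ}

lemma formQ_tmul (v w v' w' : Fin 2 → ℝ) :
    formQ (v ⊗ₜ w) (v' ⊗ₜ w') = volForm v v' * volForm w w' := by
  simp [formQ, mul_comm]

lemma twistForm_tmul (v w v' w' : Fin 2 → ℝ) :
    twistForm J₁ (v ⊗ₜ w) (v' ⊗ₜ w') = volForm v (J₁ v') * volForm w w' := by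
  simp [twistForm, mul_comm]

lemma twistProj_apply (z : (Fin 2 → ℝ) ⊗[ℝ] (Fin 2 → ℝ)) :
    twistProj J₁ J₂ s z = (2⁻¹ : ℝ) • (z + s • TensorProduct.map J₁ J₂ z) := rfl

/-- The two signs from J₁² = -1 and J₂² = -1 cancel. -/
lemma map_map_self (h₁ : IsCompatible J₁) (h₂ : IsCompatible J₂)
    (z : (Fin 2 → ℝ) ⊗[ℝ] (Fin 2 → ℝ)) :
    TensorProduct.map J₁ J₂ (TensorProduct.map J₁ J₂ z) = z := by
  induction z with
  | zero => simp
  | tmul v w => simp [h₁.sq, h₂.sq, TensorProduct.neg_tmul, TensorProduct.tmul_neg]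
  | add a b ha hb => simp [ha, hb]

lemma map_twistProj (h₁ : IsCompatible J₁) (h₂ : IsCompatible J₂) (hs : s * s = 1)
    (z : (Fin 2 → ℝ) ⊗[ℝ] (Fin 2 → ℝ)) :
    TensorProduct.map J₁ J₂ (twistProj J₁ J₂ s z) = s • twistProj J₁ J₂ s z := by
  simp only [twistProj_apply, map_smul, map_add, map_map_self h₁ h₂]
  rw [smul_comm s, smul_add s, smul_smul s s, hs, one_smul, add_comm]

lemma twistProj_of_map_eq (hs : s * s = 1) {z : (Fin 2 → ℝ) ⊗[ℝ] (Fin 2 → ℝ)}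
    (hz : TensorProduct.map J₁ J₂ z = s • z) : twistProj J₁ J₂ s z = z := by
  rw [twistProj_apply, hz, smul_smul, hs, one_smul, ← two_smul ℝ z, smul_smul]
  norm_num

/-- The projection of a product of rotated vectors, in the frame of the eigenspace given by a
product and its image under `J₁ ⊗ 1`. -/
lemma twistProj_rotate (h₁ : IsCompatible J₁) (h₂ : IsCompatible J₂) (hs : s * s = 1)
    (v w : Fin 2 → ℝ) (a b c d : ℝ) :
    twistProj J₁ J₂ s ((a • v + b • J₁ v) ⊗ₜ (c • w + d • J₂ w)) =
      (a * c + s * (b * d)) • twistProj J₁ J₂ s (v ⊗ₜ w) +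
      (b * c - s * (a * d)) • twistProj J₁ J₂ s (J₁ v ⊗ₜ w) := by
  simp only [twistProj_apply, TensorProduct.add_tmul, TensorProduct.tmul_add, map_add, map_smul,
    TensorProduct.map_tmul, h₁.sq, h₂.sq, TensorProduct.neg_tmul, TensorProduct.tmul_neg,
    ← TensorProduct.smul_tmul', ← TensorProduct.smul_tmul]
  match_scalars <;> first
    | linear_combination (-(b * d / 2)) * hs | linear_combination (b * d / 2) * hs
    | linear_combination (-(a * d / 2)) * hs | linear_combination (a * d / 2) * hs | ring

/-- Each factor of a pure tensor can be written in the basis v, J₁v or w, J₂w, and then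
`twistProj_rotate` applies. This bounds the rank of the eigenspace by two. -/
lemma twistProj_mem_span (h₁ : IsCompatible J₁) (h₂ : IsCompatible J₂) (hs : s * s = 1)
    {v w : Fin 2 → ℝ} (hv : v ≠ 0) (hw : w ≠ 0) (z : (Fin 2 → ℝ) ⊗[ℝ] (Fin 2 → ℝ)) :
    ∃ a b : ℝ, twistProj J₁ J₂ s z =
      a • twistProj J₁ J₂ s (v ⊗ₜ w) + b • twistProj J₁ J₂ s (J₁ v ⊗ₜ w) := by
  induction z with
  | zero => exact ⟨0, 0, by simp⟩
  | tmul v' w' =>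
    rw [h₁.exists_coord hv v', h₂.exists_coord hw w', twistProj_rotate h₁ h₂ hs]
    exact ⟨_, _, rfl⟩
  | add x y hx hy =>
    obtain ⟨a, b, h⟩ := hx
    obtain ⟨c, d, h'⟩ := hy
    exact ⟨a + c, b + d, by rw [map_add, h, h']; module⟩

/-- The first factor ω(·, J₁ ·) is symmetric and the second is antisymmetric, so the product is
antisymmetric. -/
lemma twistForm_isAlt (h₁ : IsCompatible J₁) : (twistForm J₁).IsAlt := by
  have key : ∀ x y, twistForm J₁ x y = -twistForm J₁ y x := by
    intro x y
    induction x with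
    | zero => simp
    | add a b ha hb => simp only [map_add, LinearMap.add_apply, ha, hb]; ring
    | tmul v w =>
      induction y with
      | zero => simp
      | add a b ha hb => simp only [map_add, LinearMap.add_apply, ha, hb]; ring
      | tmul v' w' =>
        -- Symmetry of the first factor: ω(v, Jv') = ω(Jv, J²v') = -ω(Jv, v') = ω(v', Jv).
        rw [twistForm_tmul, twistForm_tmul, ← h₁.volForm_map v, h₁.sq, volForm_swap w w',
          volForm_swap (J₁ v), map_neg, LinearMap.neg_apply]
        ring
  intro x
  have := key x x
  change twistForm J₁ x x = 0
  linarith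

/-- The sign -s found here is the reason for orienting the eigenbundle by -s times `twistForm`. -/
lemma twistForm_frame (h₁ : IsCompatible J₁) (v w : Fin 2 → ℝ) :
    twistForm J₁ (twistProj J₁ J₂ s (v ⊗ₜ w)) (twistProj J₁ J₂ s (J₁ v ⊗ₜ w)) =
      -(s / 2 * (volForm v (J₁ v) * volForm w (J₂ w))) := by
  simp only [twistProj_apply, map_add, map_smul, TensorProduct.map_tmul, LinearMap.add_apply,
    LinearMap.smul_apply, twistForm_tmul, h₁.sq, h₁.volForm_map, map_neg, volForm_self,
    volForm_swap (J₂ w) w, volForm_swap (J₁ v) v, smul_eq_mul]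
  ring

lemma formQ_frame (h₁ : IsCompatible J₁) (v w : Fin 2 → ℝ) :
    formQ (twistProj J₁ J₂ s (v ⊗ₜ w)) (twistProj J₁ J₂ s (v ⊗ₜ w)) =
      s / 2 * (volForm v (J₁ v) * volForm w (J₂ w)) := by
  simp only [twistProj_apply, map_add, map_smul, TensorProduct.map_tmul, LinearMap.add_apply,
    LinearMap.smul_apply, formQ_tmul, h₁.volForm_map, volForm_self,
    volForm_swap (J₂ w) w, volForm_swap (J₁ v) v, smul_eq_mul]
  ring

lemma formQ_frame_cross (h₁ : IsCompatible J₁) (v w : Fin 2 → ℝ) :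
    formQ (twistProj J₁ J₂ s (v ⊗ₜ w)) (twistProj J₁ J₂ s (J₁ v ⊗ₜ w)) = 0 := by
  simp only [twistProj_apply, map_add, map_smul, TensorProduct.map_tmul, LinearMap.add_apply,
    LinearMap.smul_apply, formQ_tmul, h₁.sq, map_neg, volForm_self,
    volForm_swap (J₂ w) w, volForm_swap (J₁ v) v, smul_eq_mul]
  ring

lemma formQ_symm (x y : (Fin 2 → ℝ) ⊗[ℝ] (Fin 2 → ℝ)) : formQ x y = formQ y x := by
  induction x with
  | zero => simp
  | add a b ha hb => simp only [map_add, LinearMap.add_apply, ha, hb]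
  | tmul v w =>
    induction y with
    | zero => simp
    | add a b ha hb => simp only [map_add, LinearMap.add_apply, ha, hb]
    | tmul v' w' => rw [formQ_tmul, formQ_tmul, volForm_swap v, volForm_swap w]; ring

lemma formQ_map (h₁ : IsCompatible J₁) (h₂ : IsCompatible J₂)
    (x y : (Fin 2 → ℝ) ⊗[ℝ] (Fin 2 → ℝ)) :
    formQ (TensorProduct.map J₁ J₂ x) (TensorProduct.map J₁ J₂ y) = formQ x y := by
  induction x with
  | zero => simp
  | add a b ha hb => simp only [map_add, LinearMap.add_apply, ha, hb]
  | tmul v w =>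
    induction y with
    | zero => simp
    | add a b ha hb => simp only [map_add, ha, hb]
    | tmul v' w' => simp only [TensorProduct.map_tmul, formQ_tmul, h₁.volForm_map, h₂.volForm_map]

/-- The eigenspaces of `J₁ ⊗ J₂` are orthogonal. -/
lemma formQ_eq_zero (h₁ : IsCompatible J₁) (h₂ : IsCompatible J₂)
    {x y : (Fin 2 → ℝ) ⊗[ℝ] (Fin 2 → ℝ)} (hx : TensorProduct.map J₁ J₂ x = (1 : ℝ) • x)
    (hy : TensorProduct.map J₁ J₂ y = (-1 : ℝ) • y) : formQ x y = 0 := by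
  have := formQ_map h₁ h₂ x y
  rw [hx, hy] at this
  simp at this
  linarith

/-- Definiteness of `Q` on the eigenspaces of `J₁ ⊗ J₂`. -/
lemma formQ_self_pos (h₁ : IsCompatible J₁) (h₂ : IsCompatible J₂) (hs : s * s = 1)
    {x : (Fin 2 → ℝ) ⊗[ℝ] (Fin 2 → ℝ)} (hx : TensorProduct.map J₁ J₂ x = s • x) (h0 : x ≠ 0) :
    0 < s * formQ x x := by
  have he : (Pi.single 0 1 : Fin 2 → ℝ) ≠ 0 := by simp
  obtain ⟨a, b, hab⟩ := twistProj_mem_span h₁ h₂ hs he he x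
  rw [twistProj_of_map_eq hs hx] at hab
  set e : Fin 2 → ℝ := Pi.single 0 1
  have hp := mul_pos (h₁.pos e he) (h₂.pos e he)
  have hJe : J₁ e ≠ 0 := fun h => by
    have := h₁.pos e he
    simp [h] at this
  have hQ : formQ (twistProj J₁ J₂ s (J₁ e ⊗ₜ e)) (twistProj J₁ J₂ s (J₁ e ⊗ₜ e)) =
      s / 2 * (volForm e (J₁ e) * volForm e (J₂ e)) := by
    rw [formQ_frame h₁, h₁.volForm_map]
  have hab0 : a ≠ 0 ∨ b ≠ 0 := by
    by_contra! h
    exact h0 (by rw [hab, h.1, h.2]; simp)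
  -- The two frame vectors are Q-orthogonal and have the same Q-square, because J₁ preserves ω.
  have : formQ x x = (a ^ 2 + b ^ 2) * (s / 2 * (volForm e (J₁ e) * volForm e (J₂ e))) := by
    rw [hab]
    simp only [map_add, map_smul, LinearMap.add_apply, LinearMap.smul_apply, smul_eq_mul,
      formQ_frame_cross h₁, formQ_symm (twistProj J₁ J₂ s (J₁ e ⊗ₜ e))
      (twistProj J₁ J₂ s (e ⊗ₜ e)), hQ, formQ_frame h₁]
    ring
  rw [this]
  have h2 : 0 < a ^ 2 + b ^ 2 := by rcases hab0 with h | h <;> positivity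
  calc 0 < (a ^ 2 + b ^ 2) * (volForm e (J₁ e) * volForm e (J₂ e)) / 2 := by positivity
    _ = (s * s) * ((a ^ 2 + b ^ 2) * (volForm e (J₁ e) * volForm e (J₂ e)) / 2) := by rw [hs]; ring
    _ = _ := by ring

/-- An alternating form with non-zero value on the pair detects independence. In particular the
projection of a non-zero pure tensor never vanishes, so products of sections have no new
singularities. -/
lemma linearIndependent_frame (h₁ : IsCompatible J₁) (h₂ : IsCompatible J₂) (hs : s * s = 1)
    {v w : Fin 2 → ℝ} (hv : v ≠ 0) (hw : w ≠ 0) :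
    LinearIndependent ℝ ![twistProj J₁ J₂ s (v ⊗ₜ w), twistProj J₁ J₂ s (J₁ v ⊗ₜ w)] := by
  have hs0 : s ≠ 0 := by rintro rfl; simp at hs
  have hA : twistForm J₁ (twistProj J₁ J₂ s (v ⊗ₜ w)) (twistProj J₁ J₂ s (J₁ v ⊗ₜ w)) ≠ 0 := by
    rw [twistForm_frame h₁]
    have := h₁.pos v hv
    have := h₂.pos w hw
    have : s / 2 ≠ 0 := by positivity
    have : s / 2 * (volForm v (J₁ v) * volForm w (J₂ w)) ≠ 0 := by positivity
    exact neg_ne_zero.mpr this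
  have hself := fun x => twistForm_isAlt h₁ x
  rw [LinearIndependent.pair_iff]
  intro a b h
  constructor
  · have := congrArg (fun z => twistForm J₁ z (twistProj J₁ J₂ s (J₁ v ⊗ₜ w))) h
    simpa [hself, hA] using this
  · have := congrArg (fun z => twistForm J₁ (twistProj J₁ J₂ s (v ⊗ₜ w)) z) h
    simpa [hself, hA] using this

/-- `ω(·, J₁ ·) ⊗ ω` is an area form on the eigenspaces of `J₁ ⊗ J₂`. -/
lemma twistForm_ne_zero (h₁ : IsCompatible J₁) (h₂ : IsCompatible J₂) (hs : s * s = 1)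
    {x y : (Fin 2 → ℝ) ⊗[ℝ] (Fin 2 → ℝ)} (hx : TensorProduct.map J₁ J₂ x = s • x)
    (hy : TensorProduct.map J₁ J₂ y = s • y) (hxy : LinearIndependent ℝ ![x, y]) :
    twistForm J₁ x y ≠ 0 := by
  have hs0 : s ≠ 0 := by rintro rfl; simp at hs
  have he : (Pi.single 0 1 : Fin 2 → ℝ) ≠ 0 := by simp
  obtain ⟨a, b, hab⟩ := twistProj_mem_span h₁ h₂ hs he he x
  obtain ⟨c, d, hcd⟩ := twistProj_mem_span h₁ h₂ hs he he y
  rw [twistProj_of_map_eq hs hx] at hab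
  rw [twistProj_of_map_eq hs hy] at hcd
  set e : Fin 2 → ℝ := Pi.single 0 1
  set f₁ := twistProj J₁ J₂ s (e ⊗ₜ e)
  set f₂ := twistProj J₁ J₂ s (J₁ e ⊗ₜ e)
  have hself : ∀ z, twistForm J₁ z z = 0 := fun z => twistForm_isAlt h₁ z
  have hswap : twistForm J₁ f₂ f₁ = -twistForm J₁ f₁ f₂ :=
    (LinearMap.IsAlt.neg (twistForm_isAlt h₁) f₁ f₂).symm
  have hval : twistForm J₁ x y = (a * d - b * c) * twistForm J₁ f₁ f₂ := by
    rw [hab, hcd]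
    simp only [map_add, map_smul, LinearMap.add_apply, LinearMap.smul_apply, smul_eq_mul, hself,
      hswap]
    ring
  have hdet : a * d - b * c ≠ 0 := by
    intro h
    rw [LinearIndependent.pair_iff] at hxy
    -- With zero determinant, d x - b y and c x - a y both vanish. Independence forces a = b = 0,
    -- hence x = 0, a contradiction.
    have e1 : d • x + (-b) • y = 0 := by
      rw [hab, hcd]; match_scalars <;> first | linear_combination h | ring
    have e2 : c • x + (-a) • y = 0 := by
      rw [hab, hcd]; match_scalars <;> first | linear_combination -h | ring
    have := hxy _ _ e1
    have h2 := hxy _ _ e2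
    have := hxy 1 0 (by rw [hab, neg_eq_zero.mp this.2, neg_eq_zero.mp h2.2]; simp)
    exact one_ne_zero this.1
  rw [hval, twistForm_frame h₁]
  have h3 := h₁.pos e he
  have h4 := h₂.pos e he
  have : s / 2 * (volForm e (J₁ e) * volForm e (J₂ e)) ≠ 0 := by positivity
  exact mul_ne_zero hdet (neg_ne_zero.mpr this)

/-! ### The complex structure of an equivariant metric -/

section Bundles

variable {X Γ : Type*} [Group Γ] [MulAction Γ X]

/-! ### Fibres of invariant subsets of a flat bundle -/

section General

variable {V : Type*} [AddCommGroup V] [Module ℝ V] {r : Representation ℝ Γ V}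

lemma FlatBundle.mk_eq_mk {x x' : X} {v v' : V} :
    (FlatBundle.mk x v : FlatBundle X r) = FlatBundle.mk x' v' ↔
      ∃ g : Γ, g • x = x' ∧ r g v = v' :=
  Quotient.eq (r := flatSetoid X r)

lemma FlatBundle.mk_smul (g : Γ) (x : X) (v : V) :
    (FlatBundle.mk (g • x) (r g v) : FlatBundle X r) = FlatBundle.mk x v :=
  (FlatBundle.mk_eq_mk.mpr ⟨g, rfl, rfl⟩).symm

lemma fiberAt_smul_iff {F : Set (FlatBundle X r)} (g : Γ) (x : X) (v : V) :
    r g v ∈ fiberAt F (g • x) ↔ v ∈ fiberAt F x := by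
  simp only [fiberAt, mem_ofPred_eq, FlatBundle.mk_smul]

/-- The fibres of a set which is given by an invariant family of conditions. -/
lemma fiberAt_setOf {T : X → Set V} (hT : ∀ (g : Γ) x v, v ∈ T x → r g v ∈ T (g • x)) (x : X) :
    fiberAt ({ξ | ∃ x v, ξ = FlatBundle.mk x v ∧ v ∈ T x} : Set (FlatBundle X r)) x = T x := by
  ext v
  constructor
  · rintro ⟨x', v', h, hv'⟩
    obtain ⟨g, rfl, rfl⟩ := FlatBundle.mk_eq_mk.mp h.symm
    exact hT g x' v' hv'
  · exact fun hv => ⟨x, v, rfl, hv⟩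

end General

lemma tensorRep_tmul (ρ₁ ρ₂ : Γ →* SL(2, ℝ)) (g : Γ) (v w : Fin 2 → ℝ) :
    tensorRep ρ₁ ρ₂ g (v ⊗ₜ w) = stdRep ρ₁ g v ⊗ₜ stdRep ρ₂ g w := rfl

/-- Reduces continuity and smoothness of a product, which are tested on functionals, to those of the
coordinates of its factors. -/
lemma dual_tmul (l : Module.Dual ℝ ((Fin 2 → ℝ) ⊗[ℝ] (Fin 2 → ℝ))) (v w : Fin 2 → ℝ) :
    l (v ⊗ₜ w) = ∑ i, ∑ j, v i * w j *
      l ((Pi.single i 1 : Fin 2 → ℝ) ⊗ₜ (Pi.single j 1 : Fin 2 → ℝ)) := by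
  conv_lhs => rw [pi_eq_sum_univ' v, pi_eq_sum_univ' w]
  simp only [TensorProduct.sum_tmul, TensorProduct.tmul_sum, map_sum, ← TensorProduct.smul_tmul',
    TensorProduct.tmul_smul, map_smul, smul_eq_mul]
  rw [Finset.sum_comm]
  refine Finset.sum_congr rfl fun i _ => ?_
  rw [Finset.mul_sum]
  refine Finset.sum_congr rfl fun j _ => ?_
  ring

variable [TopologicalSpace X] [ChartedSpace ℂ X]

namespace EquivariantMetric

variable {ρ : Γ →* SL(2, ℝ)} (H : EquivariantMetric X ρ)

/-- The complex structure `Ω⁻¹ H`. -/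
def complexStructure (x : X) : (Fin 2 → ℝ) →ₗ[ℝ] (Fin 2 → ℝ) :=
  Matrix.toLin' (-volMatrix * H.metric x)

lemma complexStructure_apply (x : X) (v : Fin 2 → ℝ) :
    H.complexStructure x v = ![-(H.metric x 1 0 * v 0 + H.metric x 1 1 * v 1),
      H.metric x 0 0 * v 0 + H.metric x 0 1 * v 1] := by
  ext i
  fin_cases i <;>
    simp [complexStructure, volMatrix, Matrix.mulVec, dotProduct, Fin.sum_univ_two,
      Matrix.vecMul]

lemma metric_symm (x : X) : H.metric x 1 0 = H.metric x 0 1 := by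
  have := (H.posDef x).1.apply 0 1
  simpa using this

lemma metric_det (x : X) :
    H.metric x 0 0 * H.metric x 1 1 - H.metric x 0 1 * H.metric x 0 1 = 1 := by
  have := H.det_eq_one x
  rwa [Matrix.det_fin_two, H.metric_symm] at this

lemma volForm_complexStructure (x : X) (v : Fin 2 → ℝ) :
    volForm v (H.complexStructure x v) = dotProduct v ((H.metric x).mulVec v) := by
  simp only [volForm_apply, complexStructure_apply, dotProduct, Matrix.mulVec, Fin.sum_univ_two,
    Matrix.cons_val_zero, Matrix.cons_val_one]
  ring

/-- Symmetry of the metric makes Ω⁻¹H trace-free and its determinant is 1, so its square is -1 by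
Cayley–Hamilton and it preserves ω. Positivity holds because ω(v, Jv) is the metric length squared
of v. -/
lemma isCompatible (x : X) : IsCompatible (H.complexStructure x) where
  sq v := by
    have h := H.metric_det x
    ext i
    fin_cases i
    · simp [complexStructure_apply, H.metric_symm]
      linear_combination (-(v 0)) * h
    · simp [complexStructure_apply, H.metric_symm]
      linear_combination (-(v 1)) * h
  volForm_map v w := by
    have h := H.metric_det x
    simp only [volForm_apply, complexStructure_apply, H.metric_symm, Matrix.cons_val_zero,
      Matrix.cons_val_one]
    linear_combination (v 0 * w 1 - v 1 * w 0) * h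
  pos v hv := by
    rw [volForm_complexStructure]
    simpa using (H.posDef x).dotProduct_mulVec_pos hv

/-- The deck group preserves both the metric and ω, hence also Ω⁻¹H. -/
lemma complexStructure_smul (g : Γ) (x : X) (v : Fin 2 → ℝ) :
    H.complexStructure (g • x) (stdRep ρ g v) = stdRep ρ g (H.complexStructure x v) := by
  have hd := (ρ g).det_coe
  rw [Matrix.det_fin_two] at hd
  have he := H.equivariant g x
  have h00 := congrFun (congrFun he 0) 0
  have h01 := congrFun (congrFun he 0) 1
  have h10 := congrFun (congrFun he 1) 0
  have h11 := congrFun (congrFun he 1) 1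
  simp only [Matrix.mul_apply, Fin.sum_univ_two, Matrix.transpose_apply] at h00 h01 h10 h11
  simp only [complexStructure_apply, stdRep_apply]
  rw [← h00, ← h01, ← h10, ← h11]
  ext i
  fin_cases i
  · simp [Matrix.mulVec, dotProduct, Fin.sum_univ_two]
    linear_combination (H.metric (g • x) 1 0 * ((ρ g).1 0 0 * v 0 + (ρ g).1 0 1 * v 1) +
      H.metric (g • x) 1 1 * ((ρ g).1 1 0 * v 0 + (ρ g).1 1 1 * v 1)) * hd
  · simp [Matrix.mulVec, dotProduct, Fin.sum_univ_two]
    linear_combination (-(H.metric (g • x) 0 0 * ((ρ g).1 0 0 * v 0 + (ρ g).1 0 1 * v 1) +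
      H.metric (g • x) 0 1 * ((ρ g).1 1 0 * v 0 + (ρ g).1 1 1 * v 1))) * hd

lemma continuous_metric (i j : Fin 2) : Continuous fun x => H.metric x i j :=
  (H.smooth i j).continuous

lemma contMDiff_complexStructure (v : Fin 2 → ℝ) (i : Fin 2) :
    ContMDiff 𝓘(ℝ, ℂ) 𝓘(ℝ, ℝ) ∞ fun x => H.complexStructure x v i := by
  have key : ∀ i j k l, ContMDiff 𝓘(ℝ, ℂ) 𝓘(ℝ, ℝ) ∞ fun x =>
      H.metric x i j * v k + H.metric x i l * v 1 := fun i j k l =>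
    ((H.smooth i j).mul contMDiff_const).add ((H.smooth i l).mul contMDiff_const)
  simp only [complexStructure_apply]
  fin_cases i
  · exact (key 1 0 0 1).neg
  · exact key 0 0 0 1

lemma continuousOn_complexStructure {Y : Type*} [TopologicalSpace Y] {U : Set Y} {σ : Y → X}
    {v : Y → Fin 2 → ℝ} (hσ : ContinuousOn σ U) (hv : ContinuousOn v U) :
    ContinuousOn (fun y => H.complexStructure (σ y) (v y)) U := by
  have h1 : ∀ i j, ContinuousOn (fun y => H.metric (σ y) i j) U := fun i j =>
    (H.continuous_metric i j).comp_continuousOn hσ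
  have h2 : ∀ i, ContinuousOn (fun y => v y i) U := fun i => continuousOn_pi.mp hv i
  refine continuousOn_pi.mpr fun i => ?_
  simp only [complexStructure_apply]
  fin_cases i
  · exact (((h1 1 0).mul (h2 0)).add ((h1 1 1).mul (h2 1))).neg
  · exact ((h1 0 0).mul (h2 0)).add ((h1 0 1).mul (h2 1))

end EquivariantMetric

/-! ### The eigenbundles -/

variable {ρ₁ ρ₂ : Γ →* SL(2, ℝ)} (H₁ : EquivariantMetric X ρ₁) (H₂ : EquivariantMetric X ρ₂)

/-- The endomorphism `J₁ ⊗ J₂` of the fibre at `x`. -/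
def tensorStructure (x : X) :
    (Fin 2 → ℝ) ⊗[ℝ] (Fin 2 → ℝ) →ₗ[ℝ] (Fin 2 → ℝ) ⊗[ℝ] (Fin 2 → ℝ) :=
  TensorProduct.map (H₁.complexStructure x) (H₂.complexStructure x)

/-- The projection to the eigenbundle. -/
def eigenProj (s : ℝ) (x : X) :
    (Fin 2 → ℝ) ⊗[ℝ] (Fin 2 → ℝ) →ₗ[ℝ] (Fin 2 → ℝ) ⊗[ℝ] (Fin 2 → ℝ) :=
  twistProj (H₁.complexStructure x) (H₂.complexStructure x) s

/-- The bundle of eigenvectors of `J₁ ⊗ J₂` for the eigenvalue `s`. -/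
def eigenBundle (s : ℝ) : Set (FlatBundle X (tensorRep ρ₁ ρ₂)) :=
  {ξ | ∃ x v, ξ = FlatBundle.mk x v ∧ v ∈ {v | tensorStructure H₁ H₂ x v = s • v}}

lemma tensorStructure_smul (g : Γ) (x : X) (v : (Fin 2 → ℝ) ⊗[ℝ] (Fin 2 → ℝ)) :
    tensorStructure H₁ H₂ (g • x) (tensorRep ρ₁ ρ₂ g v) =
      tensorRep ρ₁ ρ₂ g (tensorStructure H₁ H₂ x v) := by
  induction v with
  | zero => simp
  | add a b ha hb => simp only [map_add, ha, hb]
  | tmul v w =>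
    simp only [tensorRep_tmul, tensorStructure, TensorProduct.map_tmul,
      EquivariantMetric.complexStructure_smul]

lemma eigenProj_smul (s : ℝ) (g : Γ) (x : X) (v : (Fin 2 → ℝ) ⊗[ℝ] (Fin 2 → ℝ)) :
    eigenProj H₁ H₂ s (g • x) (tensorRep ρ₁ ρ₂ g v) =
      tensorRep ρ₁ ρ₂ g (eigenProj H₁ H₂ s x v) := by
  have := tensorStructure_smul H₁ H₂ g x v
  rw [tensorStructure, tensorStructure] at this
  simp only [eigenProj, twistProj_apply, this, map_add, map_smul]

lemma mem_fiberAt_eigenBundle {s : ℝ} {x : X} {v : (Fin 2 → ℝ) ⊗[ℝ] (Fin 2 → ℝ)} :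
    v ∈ fiberAt (eigenBundle H₁ H₂ s) x ↔ TensorProduct.map (H₁.complexStructure x)
      (H₂.complexStructure x) v = s • v := by
  rw [eigenBundle, fiberAt_setOf]
  · rfl
  · intro g x v hv
    rw [mem_ofPred_eq, tensorStructure_smul, hv, map_smul]

lemma eigenProj_mem {s : ℝ} (hs : s * s = 1) (x : X) (v : (Fin 2 → ℝ) ⊗[ℝ] (Fin 2 → ℝ)) :
    eigenProj H₁ H₂ s x v ∈ fiberAt (eigenBundle H₁ H₂ s) x :=
  (mem_fiberAt_eigenBundle H₁ H₂).mpr (map_twistProj (H₁.isCompatible x) (H₂.isCompatible x) hs v)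

lemma eigenProj_tmul (s : ℝ) (x : X) (v w : Fin 2 → ℝ) :
    eigenProj H₁ H₂ s x (v ⊗ₜ w) = (2⁻¹ : ℝ) • (v ⊗ₜ[ℝ] w +
      s • (H₁.complexStructure x v ⊗ₜ[ℝ] H₂.complexStructure x w)) := by
  rw [eigenProj, twistProj_apply, TensorProduct.map_tmul]

lemma continuousOn_eigenProj {Y : Type*} [TopologicalSpace Y] {U : Set Y} {σ : Y → X}
    {v w : Y → Fin 2 → ℝ} (hσ : ContinuousOn σ U) (hv : ContinuousOn v U) (hw : ContinuousOn w U)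
    (s : ℝ) (l : Module.Dual ℝ ((Fin 2 → ℝ) ⊗[ℝ] (Fin 2 → ℝ))) :
    ContinuousOn (fun y => l (eigenProj H₁ H₂ s (σ y) (v y ⊗ₜ w y))) U := by
  have key : ∀ {v w : Y → Fin 2 → ℝ}, ContinuousOn v U → ContinuousOn w U →
      ContinuousOn (fun y => l (v y ⊗ₜ w y)) U := by
    intro v w hv hw
    rw [show (fun y => l (v y ⊗ₜ w y)) = fun y => _ from funext fun y => dual_tmul l (v y) (w y)]
    exact continuousOn_finsetSum _ fun i _ => continuousOn_finsetSum _ fun j _ =>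
      ((continuousOn_pi.mp hv i).mul (continuousOn_pi.mp hw j)).mul continuousOn_const
  simp only [eigenProj_tmul, map_add, map_smul, smul_eq_mul]
  exact continuousOn_const.mul ((key hv hw).add (continuousOn_const.mul
    (key (H₁.continuousOn_complexStructure hσ hv) (H₂.continuousOn_complexStructure hσ hw))))

lemma isSubbundle_eigenBundle {s : ℝ} (hs : s * s = 1) :
    IsSubbundle (eigenBundle H₁ H₂ s) 2 := by
  intro x₀
  have he : (Pi.single 0 1 : Fin 2 → ℝ) ≠ 0 := by simp
  set e : Fin 2 → ℝ := Pi.single 0 1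
  have key : ∀ (l : Module.Dual ℝ ((Fin 2 → ℝ) ⊗[ℝ] (Fin 2 → ℝ))) {v w : X → Fin 2 → ℝ},
      (∀ i, ContMDiff 𝓘(ℝ, ℂ) 𝓘(ℝ, ℝ) ∞ fun x => v x i) →
      (∀ i, ContMDiff 𝓘(ℝ, ℂ) 𝓘(ℝ, ℝ) ∞ fun x => w x i) →
      ContMDiff 𝓘(ℝ, ℂ) 𝓘(ℝ, ℝ) ∞ fun x => l (v x ⊗ₜ w x) := by
    intro l v w hv hw
    rw [show (fun x => l (v x ⊗ₜ w x)) = fun x => _ from funext fun x => dual_tmul l (v x) (w x)]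
    exact contMDiff_finsetSum fun i _ => contMDiff_finsetSum fun j _ =>
      ((hv i).mul (hw j)).mul contMDiff_const
  have hconst : ∀ i, ContMDiff 𝓘(ℝ, ℂ) 𝓘(ℝ, ℝ) ∞ fun _ : X => e i := fun i => contMDiff_const
  -- The frame need not be Γ-invariant, so a constant vector e gives a frame over all of X.
  refine ⟨univ, isOpen_univ, mem_univ _, ![fun x => eigenProj H₁ H₂ s x (e ⊗ₜ e),
    fun x => eigenProj H₁ H₂ s x (H₁.complexStructure x e ⊗ₜ e)], ?_, ?_⟩
  · intro i l
    rw [contMDiffOn_univ]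
    fin_cases i
    · simp only [Fin.zero_eta, Matrix.cons_val_zero, eigenProj_tmul, map_add, map_smul,
        smul_eq_mul]
      exact contMDiff_const.mul ((key l hconst hconst).add (contMDiff_const.mul
        (key l (H₁.contMDiff_complexStructure e) (H₂.contMDiff_complexStructure e))))
    · simp only [Fin.mk_one, Matrix.cons_val_one, Matrix.cons_val_fin_one, eigenProj_tmul,
        map_add, map_smul, smul_eq_mul, (H₁.isCompatible _).sq, TensorProduct.neg_tmul, map_neg]
      exact contMDiff_const.mul ((key l (H₁.contMDiff_complexStructure e) hconst).add
        (contMDiff_const.mul (key l hconst (H₂.contMDiff_complexStructure e)).neg))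
  · intro x _
    have h₁ := H₁.isCompatible x
    have h₂ := H₂.isCompatible x
    have hfun : (fun i => (![fun x => eigenProj H₁ H₂ s x (e ⊗ₜ e),
        fun x => eigenProj H₁ H₂ s x (H₁.complexStructure x e ⊗ₜ e)] :
          Fin 2 → X → (Fin 2 → ℝ) ⊗[ℝ] (Fin 2 → ℝ)) i x) =
        ![eigenProj H₁ H₂ s x (e ⊗ₜ e),
          eigenProj H₁ H₂ s x (H₁.complexStructure x e ⊗ₜ e)] := by
      ext1 i; fin_cases i <;> rfl
    rw [hfun]
    refine ⟨linearIndependent_frame h₁ h₂ hs he he, ?_⟩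
    ext v
    rw [Matrix.range_cons_cons_empty, SetLike.mem_coe, Submodule.mem_span_pair]
    constructor
    · intro hv
      obtain ⟨a, b, hab⟩ := twistProj_mem_span h₁ h₂ hs he he v
      rw [twistProj_of_map_eq hs ((mem_fiberAt_eigenBundle H₁ H₂).mp hv)] at hab
      exact ⟨a, b, hab.symm⟩
    · rintro ⟨a, b, rfl⟩
      have m1 := (mem_fiberAt_eigenBundle H₁ H₂).mp (eigenProj_mem H₁ H₂ hs x (e ⊗ₜ e))
      have m2 := (mem_fiberAt_eigenBundle H₁ H₂).mp
        (eigenProj_mem H₁ H₂ hs x (H₁.complexStructure x e ⊗ₜ e))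
      rw [mem_fiberAt_eigenBundle, map_add, map_smul, map_smul, m1, m2]
      module

lemma eigenBundle_directSum (x : X) (v : (Fin 2 → ℝ) ⊗[ℝ] (Fin 2 → ℝ)) :
    ∃! q : ((Fin 2 → ℝ) ⊗[ℝ] (Fin 2 → ℝ)) × ((Fin 2 → ℝ) ⊗[ℝ] (Fin 2 → ℝ)),
      q.1 ∈ fiberAt (eigenBundle H₁ H₂ 1) x ∧ q.2 ∈ fiberAt (eigenBundle H₁ H₂ (-1)) x ∧
        q.1 + q.2 = v := by
  refine ⟨(eigenProj H₁ H₂ 1 x v, eigenProj H₁ H₂ (-1) x v),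
    ⟨eigenProj_mem H₁ H₂ (by norm_num) x v, eigenProj_mem H₁ H₂ (by norm_num) x v, ?_⟩, ?_⟩
  · simp only [eigenProj, twistProj_apply]
    module
  · rintro ⟨a, b⟩ ⟨ha, hb, rfl⟩
    rw [mem_fiberAt_eigenBundle] at ha hb
    simp only [eigenProj, twistProj_apply, map_add, ha, hb, Prod.mk.injEq]
    constructor <;> module

/-- The orientation of the eigenbundle. -/
lemma isOrientation_eigenBundle {s c : ℝ} (hs : s * s = 1) (hc : c ≠ 0) :
    IsOrientation (eigenBundle H₁ H₂ s) fun x => c • twistForm (H₁.complexStructure x) where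
  alt x v := by
    have := twistForm_isAlt (H₁.isCompatible x) v
    simp [this]
  equivariant g x v w := by
    simp only [LinearMap.smul_apply]
    congr 1
    induction v with
    | zero => simp
    | add a b ha hb => simp only [map_add, LinearMap.add_apply, ha, hb]
    | tmul v v' =>
      induction w with
      | zero => simp
      | add a b ha hb => simp only [map_add, ha, hb]
      | tmul w w' =>
        simp only [tensorRep_tmul, twistForm_tmul, volForm_stdRep,
          EquivariantMetric.complexStructure_smul]
  continuous v w := by
    simp only [LinearMap.smul_apply]
    refine continuous_const.mul ?_
    induction v with
    | zero => simpa using continuous_const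
    | add a b ha hb => simp only [map_add, LinearMap.add_apply]; exact ha.add hb
    | tmul v v' =>
      induction w with
      | zero => simpa using continuous_const
      | add a b ha hb => simp only [map_add]; exact ha.add hb
      | tmul w w' =>
        simp only [twistForm_tmul, volForm_apply v]
        have h := fun i => (H₁.contMDiff_complexStructure w i).continuous
        exact ((continuous_const.mul (h 1)).sub (continuous_const.mul (h 0))).mul
          continuous_const
  nondegenerate x v hv w hw hvw := by
    rw [mem_fiberAt_eigenBundle] at hv hw
    exact mul_ne_zero hc (twistForm_ne_zero (H₁.isCompatible x) (H₂.isCompatible x) hs hv hw hvw)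

end Bundles

/-! ### Rotation angles -/

/-- The point `(cos θ + a sin θ) + i b sin θ`, rotated back by the angle `θ`. -/
def shearRotation (a b θ : ℝ) : ℂ :=
  ⟨Real.cos θ + a * Real.sin θ, b * Real.sin θ⟩ * ⟨Real.cos θ, -Real.sin θ⟩

lemma shearRotation_re (a b θ : ℝ) : (shearRotation a b θ).re =
    Real.cos θ ^ 2 + a * Real.sin θ * Real.cos θ + b * Real.sin θ ^ 2 := by
  simp only [shearRotation, Complex.mul_re]; ring

lemma shearRotation_im (a b θ : ℝ) : (shearRotation a b θ).im =
    Real.sin θ * ((b - 1) * Real.cos θ - a * Real.sin θ) := by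
  simp only [shearRotation, Complex.mul_im]; ring

/-- A value on the closed negative axis would mean that the matrix with columns (1, 0) and (a, b)
sends (cos θ, sin θ) to a non-positive multiple of itself. Its eigenvalues 1 and b are positive. -/
lemma shearRotation_mem_slitPlane {a b : ℝ} (hb : 0 < b) (θ : ℝ) :
    shearRotation a b θ ∈ Complex.slitPlane := by
  have h := Real.sin_sq_add_cos_sq θ
  rw [Complex.mem_slitPlane_iff]
  by_contra! hc
  obtain ⟨hre, him⟩ := hc
  rw [shearRotation_re] at hre
  rw [shearRotation_im, mul_eq_zero] at him
  rcases him with h0 | h0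
  · rw [h0] at h hre
    nlinarith
  · have : Real.cos θ ^ 2 + a * Real.sin θ * Real.cos θ + b * Real.sin θ ^ 2 = b := by
      linear_combination (-Real.cos θ) * h0 + b * h
    linarith

/-- The argument of `shearRotation` is the correction to add to θ to get the polar angle of the
sheared vector. -/
lemma cos_sin_of_shearRotation (a b θ : ℝ) :
    ‖shearRotation a b θ‖ * Real.cos (θ + (shearRotation a b θ).arg) =
        Real.cos θ + a * Real.sin θ ∧
      ‖shearRotation a b θ‖ * Real.sin (θ + (shearRotation a b θ).arg) = b * Real.sin θ := by
  have h := Real.sin_sq_add_cos_sq θ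
  have hre := Complex.norm_mul_cos_arg (shearRotation a b θ)
  have him := Complex.norm_mul_sin_arg (shearRotation a b θ)
  rw [shearRotation_re] at hre
  rw [shearRotation_im] at him
  rw [Real.cos_add, Real.sin_add]
  constructor
  · linear_combination Real.cos θ * hre - Real.sin θ * him +
      (Real.cos θ + a * Real.sin θ) * h
  · linear_combination Real.sin θ * hre + Real.cos θ * him + (b * Real.sin θ) * h

/-- Both factors change sign under θ ↦ θ + π. So the correction angle returns to its value after a
full turn of a ray or of a line. -/
lemma shearRotation_add_int_mul_pi (a b θ : ℝ) (n : ℤ) :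
    shearRotation a b (θ + n * Real.pi) = shearRotation a b θ := by
  have h : Function.Periodic (shearRotation a b) Real.pi := by
    intro x
    apply Complex.ext
    · simp only [shearRotation_re, Real.cos_add_pi, Real.sin_add_pi]; ring
    · simp only [shearRotation_im, Real.cos_add_pi, Real.sin_add_pi]; ring
  exact h.int_mul n θ

lemma CircleKind.period_eq (κ : CircleKind) : ∃ m : ℤ, κ.period = m * Real.pi := by
  cases κ
  · exact ⟨2, by simp [CircleKind.period]⟩
  · exact ⟨1, by simp [CircleKind.period]⟩

lemma CircleKind.mem_scalars_of_pos (κ : CircleKind) {c : ℝ} (hc : 0 < c) : c ∈ κ.scalars := by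
  cases κ
  · exact hc
  · exact hc.ne'

lemma CircleKind.mul_mem_scalars (κ : CircleKind) {c d : ℝ} (hc : c ∈ κ.scalars)
    (hd : d ∈ κ.scalars) : c * d ∈ κ.scalars := by
  cases κ
  · exact mul_pos (mem_Ioi.mp hc) (mem_Ioi.mp hd)
  · exact mul_ne_zero hc hd

/-! ### Reversing the orientation -/

section Euler

variable {S X Γ : Type*} [TopologicalSpace S] [ChartedSpace ℂ S] [TopologicalSpace X]
  [Group Γ] [MulAction Γ X] {p : X → S} {κ : CircleKind}

/-- Replacing f₂ by -f₂ makes the frame positive for the opposite orientation and replaces the angle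
by its negative. -/
lemma HasIndexAt.neg {V : Type*} [AddCommGroup V] [Module ℝ V] {r : Representation ℝ Γ V}
    {F C : Set (FlatBundle X r)} {A : X → LinearMap.BilinForm ℝ V} {x : X} {n : ℤ}
    (hF : ∀ x, ∀ v ∈ fiberAt F x, -v ∈ fiberAt F x) (h : HasIndexAt p κ F A C x n) :
    HasIndexAt p κ F (fun x => -A x) C x (-n) := by
  obtain ⟨R, σ, f₁, f₂, hR, hball, hσx, hσ, hpσ, hf₁, hf₂, hf, hθ⟩ := h
  refine ⟨R, σ, f₁, fun w => -f₂ w, hR, hball, hσx, hσ, hpσ, hf₁, ?_, ?_, ?_⟩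
  · intro l
    simp only [map_neg]
    exact (hf₂ l).neg
  · intro w hw
    obtain ⟨h1, h2, h3⟩ := hf w hw
    exact ⟨h1, hF _ _ h2, by simpa using h3⟩
  · intro ε hε
    obtain ⟨θ, hc, hm, hend⟩ := hθ ε hε
    refine ⟨fun t => -θ t, hc.neg, fun t ht => ?_, ?_⟩
    · simpa using hm t ht
    · push_cast
      linear_combination -hend

lemma HasEulerNumber.neg {V : Type*} [AddCommGroup V] [Module ℝ V] {r : Representation ℝ Γ V}
    {F : Set (FlatBundle X r)} {A : X → LinearMap.BilinForm ℝ V} {n : ℤ}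
    (hF : ∀ x, ∀ v ∈ fiberAt F x, -v ∈ fiberAt F x) (h : HasEulerNumber p κ F A n) :
    HasEulerNumber p κ F (fun x => -A x) (-n) := by
  obtain ⟨Z, C, ind, hC, hind, hsum⟩ := h
  exact ⟨Z, C, fun z => -ind z, hC, fun x hx => (hind x hx).neg hF, by
    rw [Finset.sum_neg_distrib, hsum]⟩

/-! ### Regular points -/

lemma circleMap_mem_ball_of_mem_Ioo {c : ℂ} {ε R : ℝ} (hε : ε ∈ Ioo 0 R) (t : ℝ) :
    circleMap c ε t ∈ Metric.ball c R := by
  simpa [circleMap, dist_eq_norm, abs_of_pos hε.1] using hε.2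

lemma circleMap_two_pi (c : ℂ) (ε : ℝ) : circleMap c ε (2 * Real.pi) = circleMap c ε 0 := by
  simp [circleMap]

/-- A local section of `p` over a small coordinate disc. -/
lemma exists_local_lift (hp : IsLocalHomeomorph p) (x : X) {U : Set X} (hU : U ∈ 𝓝 x) :
    ∃ (R : ℝ) (σ : ℂ → X), 0 < R ∧
      Metric.ball (chartAt ℂ (p x) (p x)) R ⊆ (chartAt ℂ (p x)).target ∧
      σ (chartAt ℂ (p x) (p x)) = x ∧
      ContinuousOn σ (Metric.ball (chartAt ℂ (p x) (p x)) R) ∧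
      (∀ w ∈ Metric.ball (chartAt ℂ (p x) (p x)) R, p (σ w) = (chartAt ℂ (p x)).symm w) ∧
      ∀ w ∈ Metric.ball (chartAt ℂ (p x) (p x)) R, σ w ∈ U := by
  set e := chartAt ℂ (p x)
  set E := e.symm.trans (hp.localInverseAt x)
  have hx : p x ∈ e.source := mem_chart_source ℂ (p x)
  have h1 : hp.localInverseAt x (p x) = x := by
    simp
  have hEx : E (e (p x)) = x := by
    simp [E, e.left_inv hx, h1]
  have hw : e (p x) ∈ E.source := by
    simp [E, e.left_inv hx, e.map_source hx]
  have hmem : E.source ∩ E ⁻¹' U ∈ 𝓝 (e (p x)) :=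
    Filter.inter_mem (E.open_source.mem_nhds hw)
      ((E.continuousAt hw).preimage_mem_nhds (by rwa [hEx]))
  obtain ⟨R, hR, hball⟩ := Metric.mem_nhds_iff.mp hmem
  refine ⟨R, E, hR, fun w h => ?_, hEx, E.continuousOn.mono fun w h => (hball h).1,
    fun w h => ?_, fun w h => (hball h).2⟩
  · have := (hball h).1
    simp only [E, OpenPartialHomeomorph.trans_source] at this
    exact this.1
  · have := (hball h).1
    simp only [E, OpenPartialHomeomorph.trans_source] at this
    have h2 := (hp.localInverseAt x).left_inv this.2
    simpa [E] using h2

/-- At a point where a section of the circle bundle of a flat plane bundle is continuous, its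
index vanishes. -/
lemma hasIndexAt_zero (hp : IsLocalHomeomorph p) {ρ : Γ →* SL(2, ℝ)} {Z : Set S}
    {C : Set (FlatBundle X (stdRep ρ))} (hC : IsCircleSection p κ univ Z C) {x : X}
    (hx : p x ∉ Z) : HasIndexAt p κ univ (fun _ => volForm) C x 0 := by
  obtain ⟨U, hU, hxU, u, hu, hu'⟩ := hC x hx
  have hu0 : ∀ i, ContinuousOn (fun y => u y i) U := fun i => hu (LinearMap.proj i)
  let c : X → ℂ := fun y => ⟨u y 0, u y 1⟩
  have hc : ContinuousOn c U := by
    have : c = fun y => (u y 0 : ℂ) + (u y 1 : ℂ) * Complex.I := by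
      ext y; simp [c, Complex.mk_eq_add_mul_I]
    rw [this]
    exact (Complex.continuous_ofReal.comp_continuousOn (hu0 0)).add
      ((Complex.continuous_ofReal.comp_continuousOn (hu0 1)).mul continuousOn_const)
  have hc0 : ∀ y ∈ U, c y ≠ 0 := by
    intro y hy h
    refine (hu' y hy).1 ?_
    ext i
    fin_cases i
    · exact congrArg Complex.re h
    · exact congrArg Complex.im h
  -- Near x the section stays within a half turn of its direction at x, so the principal argument of
  -- the quotient is continuous.
  have hV : U ∩ (fun y => c y / c x) ⁻¹' Complex.slitPlane ∈ 𝓝 x := by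
    have hcx : ContinuousAt (fun y => c y / c x) x :=
      (hc.continuousAt (hU.mem_nhds hxU)).div_const _
    refine Filter.inter_mem (hU.mem_nhds hxU) (hcx.preimage_mem_nhds ?_)
    rw [div_self (hc0 x hxU)]
    exact Complex.isOpen_slitPlane.mem_nhds Complex.one_mem_slitPlane
  obtain ⟨R, σ, hR, hball, hσx, hσ, hpσ, hσV⟩ := exists_local_lift hp x hV
  refine ⟨R, σ, fun _ => Pi.single 0 1, fun _ => Pi.single 1 1, hR, hball, hσx, hσ, hpσ,
    fun _ => continuousOn_const, fun _ => continuousOn_const,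
    fun w _ => ⟨mem_univ _, mem_univ _, by simp [volForm_apply]⟩, fun ε hε => ?_⟩
  have hcirc : ∀ t, circleMap (chartAt ℂ (p x) (p x)) ε t ∈
      Metric.ball (chartAt ℂ (p x) (p x)) R := circleMap_mem_ball_of_mem_Ioo hε
  have hσc : Continuous fun t => σ (circleMap (chartAt ℂ (p x) (p x)) ε t) :=
    hσ.comp_continuous (continuous_circleMap _ _) hcirc
  have hcc : Continuous fun t => c (σ (circleMap (chartAt ℂ (p x) (p x)) ε t)) :=
    hc.comp_continuous hσc fun t => (hσV _ (hcirc t)).1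
  -- This angle is a function of the point on the circle, so its total change is zero.
  refine ⟨fun t => (c x).arg + (c (σ (circleMap (chartAt ℂ (p x) (p x)) ε t)) / c x).arg,
    ?_, fun t _ => ?_, ?_⟩
  · refine continuous_const.add (continuous_iff_continuousAt.mpr fun t => ?_)
    exact (Complex.continuousAt_arg (hσV _ (hcirc t)).2).comp
      (f := fun t => c (σ (circleMap (chartAt ℂ (p x) (p x)) ε t)) / c x)
      (hcc.div_const _).continuousAt
  · set y := σ (circleMap (chartAt ℂ (p x) (p x)) ε t)
    have hyU : y ∈ U := (hσV _ (hcirc t)).1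
    rw [(hu' y hyU).2.2]
    have hn : 0 < ‖c y‖ := norm_pos_iff.mpr (hc0 y hyU)
    refine ⟨‖c y‖⁻¹, κ.mem_scalars_of_pos (inv_pos.mpr hn), ?_⟩
    set α := (c x).arg + (c y / c x).arg
    have hexp : (‖c y‖ : ℂ) * Complex.exp (α * Complex.I) = c y := by
      have e1 := Complex.norm_mul_exp_arg_mul_I (c x)
      have e2 := Complex.norm_mul_exp_arg_mul_I (c y / c x)
      have e3 : c y = c x * (c y / c x) := by
        field_simp [hc0 x hxU]
      have e4 : (‖c y‖ : ℂ) = ‖c x‖ * ‖c y / c x‖ := by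
        rw [← Complex.ofReal_mul, ← norm_mul, ← e3]
      calc (‖c y‖ : ℂ) * Complex.exp (α * Complex.I)
          = (‖c x‖ * Complex.exp ((c x).arg * Complex.I)) *
            (‖c y / c x‖ * Complex.exp ((c y / c x).arg * Complex.I)) := by
            rw [e4]
            simp only [α, Complex.ofReal_add, add_mul, Complex.exp_add]
            ring
        _ = c y := by rw [e1, e2, ← e3]
    have hre := congrArg Complex.re hexp
    have him := congrArg Complex.im hexp
    simp only [Complex.re_ofReal_mul, Complex.im_ofReal_mul, Complex.exp_ofReal_mul_I_re,
      Complex.exp_ofReal_mul_I_im] at hre him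
    ext i
    fin_cases i
    · simp only [Fin.zero_eta, Pi.add_apply, Pi.smul_apply, smul_eq_mul]
      rw [show u y 0 = ‖c y‖ * Real.cos α from hre.symm]
      simp [hn.ne', α, y]
    · simp only [Fin.mk_one, Pi.add_apply, Pi.smul_apply, smul_eq_mul]
      rw [show u y 1 = ‖c y‖ * Real.sin α from him.symm]
      simp [hn.ne', α, y]
  · simp [circleMap_two_pi]

end Euler

/-! ### Sections of the eigenbundles -/

section TensorSection

variable {S X Γ : Type*} [TopologicalSpace S] [ChartedSpace ℂ S]
  [TopologicalSpace X] [ChartedSpace ℂ X] [Group Γ] [MulAction Γ X] {p : X → S} {κ : CircleKind}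

/-- The section `C` of the circle bundle has index `n` at `p x`, measured in a frame of the form
`v, J v`. -/
def HasComplexIndexAt {ρ : Γ →* SL(2, ℝ)} (p : X → S) (κ : CircleKind)
    (H : EquivariantMetric X ρ) (C : Set (FlatBundle X (stdRep ρ))) (x : X) (n : ℤ) : Prop :=
  let e := chartAt ℂ (p x)
  let w₀ : ℂ := e (p x)
  ∃ (R : ℝ) (σ : ℂ → X) (v : ℂ → Fin 2 → ℝ), 0 < R ∧
    Metric.ball w₀ R ⊆ e.target ∧
    σ w₀ = x ∧ ContinuousOn σ (Metric.ball w₀ R) ∧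
    (∀ w ∈ Metric.ball w₀ R, p (σ w) = e.symm w) ∧
    ContinuousOn v (Metric.ball w₀ R) ∧
    (∀ w ∈ Metric.ball w₀ R, v w ≠ 0) ∧
    ∀ ε ∈ Ioo (0 : ℝ) R, ∃ φ : ℝ → ℝ, Continuous φ ∧
      (∀ t ∈ Icc (0 : ℝ) (2 * Real.pi), ∃ c : ℝ, 0 < c ∧
        c • (Real.cos (φ t) • v (circleMap w₀ ε t) + Real.sin (φ t) •
          H.complexStructure (σ (circleMap w₀ ε t)) (v (circleMap w₀ ε t))) ∈
          fiberAt C (σ (circleMap w₀ ε t))) ∧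
      φ (2 * Real.pi) - φ 0 = n * κ.period

lemma continuousOn_of_dual {Y : Type*} [TopologicalSpace Y] {U : Set Y} {u : Y → Fin 2 → ℝ}
    (hu : ∀ l : Module.Dual ℝ (Fin 2 → ℝ), ContinuousOn (fun y => l (u y)) U) :
    ContinuousOn u U :=
  continuousOn_pi.mpr fun i => hu (LinearMap.proj i)

lemma continuousOn_volForm {Y : Type*} [TopologicalSpace Y] {U : Set Y} {u v : Y → Fin 2 → ℝ}
    (hu : ContinuousOn u U) (hv : ContinuousOn v U) :
    ContinuousOn (fun y => volForm (u y) (v y)) U := by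
  simp only [volForm_apply]
  have hu := continuousOn_pi.mp hu
  have hv := continuousOn_pi.mp hv
  exact ((hu 0).mul (hv 1)).sub ((hu 1).mul (hv 0))

/-- Keeping f₁ and replacing f₂ by Jf₁ is a positive shear of frames. It changes the angle by a
correction in (-π, π) with equal values at both ends of the circle, so the index is the same. -/
lemma HasIndexAt.hasComplexIndexAt {ρ : Γ →* SL(2, ℝ)} (H : EquivariantMetric X ρ)
    {C : Set (FlatBundle X (stdRep ρ))} {x : X} {n : ℤ}
    (h : HasIndexAt p κ univ (fun _ => volForm) C x n) : HasComplexIndexAt p κ H C x n := by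
  obtain ⟨R, σ, f₁, f₂, hR, hball, hσx, hσ, hpσ, hf₁, hf₂, hf, hθ⟩ := h
  have hf₁ := continuousOn_of_dual hf₁
  have hf₂ := continuousOn_of_dual hf₂
  have hf0 : ∀ w ∈ Metric.ball (chartAt ℂ (p x) (p x)) R, f₁ w ≠ 0 := fun w hw h0 => by
    have := (hf w hw).2.2
    simp [h0] at this
  refine ⟨R, σ, f₁, hR, hball, hσx, hσ, hpσ, hf₁, hf0, fun ε hε => ?_⟩
  obtain ⟨θ, hc, hm, hend⟩ := hθ ε hε
  set γ := circleMap (chartAt ℂ (p x) (p x)) ε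
  have hγ : ∀ t, γ t ∈ Metric.ball (chartAt ℂ (p x) (p x)) R := circleMap_mem_ball_of_mem_Ioo hε
  have hγc : Continuous γ := continuous_circleMap _ _
  let Jf : ℂ → Fin 2 → ℝ := fun w => H.complexStructure (σ w) (f₁ w)
  have hJf : ContinuousOn Jf (Metric.ball (chartAt ℂ (p x) (p x)) R) :=
    H.continuousOn_complexStructure hσ hf₁
  have hd : ∀ w ∈ Metric.ball (chartAt ℂ (p x) (p x)) R, 0 < volForm (f₁ w) (Jf w) :=
    fun w hw => (H.isCompatible (σ w)).pos _ (hf0 w hw)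
  -- The coordinates of f₂ in the basis f₁, Jf₁; b is positive because both frames are.
  let a : ℝ → ℝ := fun t => volForm (f₂ (γ t)) (Jf (γ t)) / volForm (f₁ (γ t)) (Jf (γ t))
  let b : ℝ → ℝ := fun t => volForm (f₁ (γ t)) (f₂ (γ t)) / volForm (f₁ (γ t)) (Jf (γ t))
  have ha : Continuous a :=
    ((continuousOn_volForm hf₂ hJf).div (continuousOn_volForm hf₁ hJf)
      fun w hw => (hd w hw).ne').comp_continuous hγc hγ
  have hb : Continuous b :=
    ((continuousOn_volForm hf₁ hf₂).div (continuousOn_volForm hf₁ hJf)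
      fun w hw => (hd w hw).ne').comp_continuous hγc hγ
  have hb0 : ∀ t, 0 < b t := fun t => div_pos (hf _ (hγ t)).2.2 (hd _ (hγ t))
  have hslit := fun t => shearRotation_mem_slitPlane (a := a t) (hb0 t) (θ t)
  have hz : Continuous fun t => shearRotation (a t) (b t) (θ t) := by
    simp only [shearRotation, Complex.mk_eq_add_mul_I]
    fun_prop
  refine ⟨fun t => θ t + (shearRotation (a t) (b t) (θ t)).arg, ?_, fun t ht => ?_, ?_⟩
  · refine hc.add (continuous_iff_continuousAt.mpr fun t => ?_)
    exact (Complex.continuousAt_arg (hslit t)).comp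
      (f := fun t => shearRotation (a t) (b t) (θ t)) hz.continuousAt
  · refine ⟨‖shearRotation (a t) (b t) (θ t)‖,
      norm_pos_iff.mpr (Complex.slitPlane_ne_zero (hslit t)), ?_⟩
    obtain ⟨h1, h2⟩ := cos_sin_of_shearRotation (a t) (b t) (θ t)
    rw [smul_add, smul_smul, smul_smul, h1, h2]
    convert hm t ht using 1
    conv_rhs => rw [(H.isCompatible (σ (γ t))).exists_coord (hf0 _ (hγ t)) (f₂ (γ t))]
    change (Real.cos (θ t) + a t * Real.sin (θ t)) • f₁ (γ t) + (b t * Real.sin (θ t)) •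
      Jf (γ t) = Real.cos (θ t) • f₁ (γ t) + Real.sin (θ t) • (a t • f₁ (γ t) + b t • Jf (γ t))
    module
  · obtain ⟨m, hm⟩ := κ.period_eq
    have hγ0 : γ (2 * Real.pi) = γ 0 := circleMap_two_pi _ _
    have hθ0 : θ (2 * Real.pi) = θ 0 + (n * m : ℤ) * Real.pi := by
      push_cast
      rw [hm] at hend
      linarith
    have ha0 : a (2 * Real.pi) = a 0 := by simp only [a, hγ0]
    have hb0 : b (2 * Real.pi) = b 0 := by simp only [b, hγ0]
    simp only [ha0, hb0]
    rw [show shearRotation (a 0) (b 0) (θ (2 * Real.pi)) = shearRotation (a 0) (b 0) (θ 0) by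
      rw [hθ0, shearRotation_add_int_mul_pi]]
    linarith

variable {ρ₁ ρ₂ : Γ →* SL(2, ℝ)} (H₁ : EquivariantMetric X ρ₁) (H₂ : EquivariantMetric X ρ₂)
  {C₁ : Set (FlatBundle X (stdRep ρ₁))} {C₂ : Set (FlatBundle X (stdRep ρ₂))}

/-- The projections of the products of two sections to the eigenbundle. -/
def tensorSection (s : ℝ) (C₁ : Set (FlatBundle X (stdRep ρ₁)))
    (C₂ : Set (FlatBundle X (stdRep ρ₂))) : Set (FlatBundle X (tensorRep ρ₁ ρ₂)) :=
  {ξ | ∃ x v, ξ = FlatBundle.mk x v ∧ v ∈ {v | ∃ c : ℝ, 0 < c ∧ ∃ v₁ ∈ fiberAt C₁ x,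
    ∃ v₂ ∈ fiberAt C₂ x, v = c • eigenProj H₁ H₂ s x (v₁ ⊗ₜ v₂)}}

lemma mem_fiberAt_tensorSection {s : ℝ} {x : X} {v : (Fin 2 → ℝ) ⊗[ℝ] (Fin 2 → ℝ)} :
    v ∈ fiberAt (tensorSection H₁ H₂ s C₁ C₂) x ↔ ∃ c : ℝ, 0 < c ∧ ∃ v₁ ∈ fiberAt C₁ x,
      ∃ v₂ ∈ fiberAt C₂ x, v = c • eigenProj H₁ H₂ s x (v₁ ⊗ₜ v₂) := by
  rw [tensorSection, fiberAt_setOf]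
  · rfl
  · rintro g x v ⟨c, hc, v₁, h₁, v₂, h₂, rfl⟩
    refine ⟨c, hc, _, (fiberAt_smul_iff g x v₁).mpr h₁, _, (fiberAt_smul_iff g x v₂).mpr h₂, ?_⟩
    rw [map_smul, ← tensorRep_tmul, eigenProj_smul]

/-- The projection is non-zero on products of non-zero vectors, and the admissible scalars are
closed under products, so rays multiply to rays and lines to lines. -/
lemma isCircleSection_tensorSection {s : ℝ} (hs : s * s = 1) {Z₁ Z₂ : Set S}
    (h₁ : IsCircleSection p κ univ Z₁ C₁) (h₂ : IsCircleSection p κ univ Z₂ C₂) :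
    IsCircleSection p κ (eigenBundle H₁ H₂ s) (Z₁ ∪ Z₂) (tensorSection H₁ H₂ s C₁ C₂) := by
  intro x₀ hx₀
  rw [mem_union, not_or] at hx₀
  obtain ⟨U₁, hU₁, hx₁, u₁, hu₁, hC₁⟩ := h₁ x₀ hx₀.1
  obtain ⟨U₂, hU₂, hx₂, u₂, hu₂, hC₂⟩ := h₂ x₀ hx₀.2
  refine ⟨U₁ ∩ U₂, hU₁.inter hU₂, ⟨hx₁, hx₂⟩, fun x => eigenProj H₁ H₂ s x (u₁ x ⊗ₜ u₂ x),
    fun l => continuousOn_eigenProj H₁ H₂ continuousOn_id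
      ((continuousOn_of_dual hu₁).mono inter_subset_left)
      ((continuousOn_of_dual hu₂).mono inter_subset_right) s l, ?_⟩
  rintro x ⟨hxU₁, hxU₂⟩
  obtain ⟨n₁, -, e₁⟩ := hC₁ x hxU₁
  obtain ⟨n₂, -, e₂⟩ := hC₂ x hxU₂
  refine ⟨(linearIndependent_frame (H₁.isCompatible x) (H₂.isCompatible x) hs n₁ n₂).ne_zero 0,
    eigenProj_mem H₁ H₂ hs x _, ?_⟩
  ext v
  rw [mem_fiberAt_tensorSection, e₁, e₂]
  constructor
  · rintro ⟨c, hc, _, ⟨c₁, hc₁, rfl⟩, _, ⟨c₂, hc₂, rfl⟩, rfl⟩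
    refine ⟨c * (c₁ * c₂), κ.mul_mem_scalars (κ.mem_scalars_of_pos hc)
      (κ.mul_mem_scalars hc₁ hc₂), ?_⟩
    rw [TensorProduct.smul_tmul_smul, map_smul, smul_smul]
  · rintro ⟨c, hc, rfl⟩
    refine ⟨1, one_pos, c • u₁ x, ⟨c, hc, rfl⟩, u₂ x,
      ⟨1, κ.mem_scalars_of_pos one_pos, (one_smul ℝ _).symm⟩, ?_⟩
    rw [one_smul, ← TensorProduct.smul_tmul', map_smul]

/-- The index of the product of two sections. -/
lemma hasIndexAt_tensorSection (hp : IsCoveringMap p) {s : ℤ} (hs : s * s = 1) {x : X} {n₁ n₂ : ℤ}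
    (h₁ : HasComplexIndexAt p κ H₁ C₁ x n₁) (h₂ : HasComplexIndexAt p κ H₂ C₂ x n₂) :
    HasIndexAt p κ (eigenBundle H₁ H₂ s)
      (fun x => (-s : ℝ) • twistForm (H₁.complexStructure x))
      (tensorSection H₁ H₂ s C₁ C₂) x (n₁ - s * n₂) := by
  have hs' : (s : ℝ) * s = 1 := by exact_mod_cast hs
  obtain ⟨R₁, σ, v, hR₁, hball₁, hσx, hσ, hpσ, hv, hv0, hφ₁⟩ := h₁
  obtain ⟨R₂, τ, w, hR₂, -, hτx, hτ, hpτ, hw, hw0, hφ₂⟩ := h₂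
  set z₀ := chartAt ℂ (p x) (p x)
  have hb₁ : Metric.ball z₀ (min R₁ R₂) ⊆ Metric.ball z₀ R₁ :=
    Metric.ball_subset_ball (min_le_left _ _)
  have hb₂ : Metric.ball z₀ (min R₁ R₂) ⊆ Metric.ball z₀ R₂ :=
    Metric.ball_subset_ball (min_le_right _ _)
  have hR : 0 < min R₁ R₂ := lt_min hR₁ hR₂
  -- Both indices must be read along one lift of the disc. Lifts through a covering with the same
  -- value at the centre agree on the ball.
  have hστ : EqOn σ τ (Metric.ball z₀ (min R₁ R₂)) :=
    hp.eqOn_of_comp_eqOn (convex_ball z₀ _).isPreconnected (hσ.mono hb₁) (hτ.mono hb₂)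
      (fun z hz => by simp only [Function.comp_apply, hpσ z (hb₁ hz), hpτ z (hb₂ hz)])
      (Metric.mem_ball_self hR) (hσx.trans hτx.symm)
  have hσ := hσ.mono hb₁
  have hv := hv.mono hb₁
  have hw := hw.mono hb₂
  refine ⟨min R₁ R₂, σ, fun z => eigenProj H₁ H₂ s (σ z) (v z ⊗ₜ w z),
    fun z => eigenProj H₁ H₂ s (σ z) (H₁.complexStructure (σ z) (v z) ⊗ₜ w z), hR,
    hb₁.trans hball₁, hσx, hσ, fun z hz => hpσ z (hb₁ hz),
    fun l => continuousOn_eigenProj H₁ H₂ hσ hv hw s l,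
    fun l => continuousOn_eigenProj H₁ H₂ hσ (H₁.continuousOn_complexStructure hσ hv) hw s l,
    fun z hz => ⟨eigenProj_mem H₁ H₂ hs' _ _, eigenProj_mem H₁ H₂ hs' _ _, ?_⟩, fun ε hε => ?_⟩
  · have h1 := (H₁.isCompatible (σ z)).pos _ (hv0 z (hb₁ hz))
    have h2 := (H₂.isCompatible (σ z)).pos _ (hw0 z (hb₂ hz))
    simp only [LinearMap.smul_apply, eigenProj]
    rw [twistForm_frame (H₁.isCompatible (σ z)), smul_eq_mul]
    have h3 := mul_pos h1 h2
    calc 0 < (s * s : ℝ) / 2 * (volForm (v z) (H₁.complexStructure (σ z) (v z)) *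
          volForm (w z) (H₂.complexStructure (σ z) (w z))) := by rw [hs']; positivity
      _ = _ := by ring
  · obtain ⟨φ₁, hc₁, hm₁, hend₁⟩ := hφ₁ ε ⟨hε.1, hε.2.trans_le (min_le_left _ _)⟩
    obtain ⟨φ₂, hc₂, hm₂, hend₂⟩ := hφ₂ ε ⟨hε.1, hε.2.trans_le (min_le_right _ _)⟩
    -- By `twistProj_rotate` the coordinates are cos φ₁ cos φ₂ + s sin φ₁ sin φ₂ and sin φ₁ cos φ₂ -
    -- s cos φ₁ sin φ₂, the cosine and sine of φ₁ - sφ₂ as s = ±1.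
    refine ⟨fun t => φ₁ t - s * φ₂ t, hc₁.sub (continuous_const.mul hc₂), fun t ht => ?_, ?_⟩
    · obtain ⟨c₁, hc₁0, hmem₁⟩ := hm₁ t ht
      obtain ⟨c₂, hc₂0, hmem₂⟩ := hm₂ t ht
      rw [← hστ (circleMap_mem_ball_of_mem_Ioo hε t)] at hmem₂
      rw [mem_fiberAt_tensorSection]
      refine ⟨(c₁ * c₂)⁻¹, by positivity, _, hmem₁, _, hmem₂, ?_⟩
      rw [TensorProduct.smul_tmul_smul, map_smul, smul_smul, inv_mul_cancel₀ (by positivity),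
        one_smul, eigenProj, twistProj_rotate (H₁.isCompatible _) (H₂.isCompatible _) hs']
      have hcos : Real.cos (s * φ₂ t) = Real.cos (φ₂ t) ∧
          Real.sin (s * φ₂ t) = s * Real.sin (φ₂ t) := by
        rcases Int.isUnit_iff.mp (IsUnit.of_mul_eq_one s hs) with rfl | rfl <;> simp
      rw [Real.cos_sub, Real.sin_sub, hcos.1, hcos.2]
      congr 2
      · ring
      · ring
    · push_cast
      linear_combination hend₁ - s * hend₂

lemma neg_mem_fiberAt_eigenBundle {s : ℝ} (x : X) (v : (Fin 2 → ℝ) ⊗[ℝ] (Fin 2 → ℝ))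
    (hv : v ∈ fiberAt (eigenBundle H₁ H₂ s) x) : -v ∈ fiberAt (eigenBundle H₁ H₂ s) x := by
  rw [mem_fiberAt_eigenBundle] at hv ⊢
  rw [map_neg, hv, smul_neg]

/-- The Euler number of the eigenbundle. -/
lemma hasEulerNumber_eigenBundle (hp : IsCoveringMap p) {s : ℤ} (hs : s * s = 1) {e₁ e₂ : ℤ}
    (h₁ : HasEulerNumber p κ (univ : Set (FlatBundle X (stdRep ρ₁))) (fun _ => volForm) e₁)
    (h₂ : HasEulerNumber p κ (univ : Set (FlatBundle X (stdRep ρ₂))) (fun _ => volForm) e₂) :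
    HasEulerNumber p κ (eigenBundle H₁ H₂ s)
      (fun x => (-s : ℝ) • twistForm (H₁.complexStructure x)) (e₁ - s * e₂) := by
  classical
  have hs' : (s : ℝ) * s = 1 := by exact_mod_cast hs
  have key : ∀ {ρ : Γ →* SL(2, ℝ)} (H : EquivariantMetric X ρ) {Z : Finset S}
      {C : Set (FlatBundle X (stdRep ρ))} {ind : S → ℤ},
      IsCircleSection p κ univ (Z : Set S) C →
      (∀ x, p x ∈ Z → HasIndexAt p κ univ (fun _ => volForm) C x (ind (p x))) → ∀ x,
      HasComplexIndexAt p κ H C x (if p x ∈ Z then ind (p x) else 0) := by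
    intro ρ H Z C ind hC hind x
    split_ifs with hx
    · exact (hind x hx).hasComplexIndexAt H
    · exact (hasIndexAt_zero hp.isLocalHomeomorph hC (by simpa using hx)).hasComplexIndexAt H
  obtain ⟨Z₁, C₁, ind₁, hC₁, hind₁, hsum₁⟩ := h₁
  obtain ⟨Z₂, C₂, ind₂, hC₂, hind₂, hsum₂⟩ := h₂
  refine ⟨Z₁ ∪ Z₂, tensorSection H₁ H₂ s C₁ C₂,
    -- A point singular for only one factor contributes index 0 from the other, so sums over the
    -- union reduce to the original ones.
    fun z => (if z ∈ Z₁ then ind₁ z else 0) - s * (if z ∈ Z₂ then ind₂ z else 0), ?_,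
    fun x _ => hasIndexAt_tensorSection H₁ H₂ hp hs (key H₁ hC₁ hind₁ x) (key H₂ hC₂ hind₂ x), ?_⟩
  · rw [Finset.coe_union]
    exact isCircleSection_tensorSection H₁ H₂ hs' hC₁ hC₂
  · rw [Finset.sum_sub_distrib, ← Finset.mul_sum, Finset.sum_ite_mem, Finset.sum_ite_mem,
      Finset.union_inter_cancel_left, Finset.union_inter_cancel_right, hsum₁, hsum₂]

lemma exists_orientation_eigenBundle (hp : IsCoveringMap p) {s : ℤ} (hs : s * s = 1) {e₁ e₂ : ℤ}
    (h₁ : HasEulerNumber p κ (univ : Set (FlatBundle X (stdRep ρ₁))) (fun _ => volForm) e₁)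
    (h₂ : HasEulerNumber p κ (univ : Set (FlatBundle X (stdRep ρ₂))) (fun _ => volForm) e₂) :
    ∃ A, IsOrientation (eigenBundle H₁ H₂ s) A ∧
      HasEulerNumber p κ (eigenBundle H₁ H₂ s) A |e₁ - s * e₂| := by
  have hs' : (s : ℝ) * s = 1 := by exact_mod_cast hs
  have hs0 : (s : ℝ) ≠ 0 := by rintro h; simp [h] at hs'
  have h := hasEulerNumber_eigenBundle H₁ H₂ hp hs h₁ h₂
  rcases abs_choice (e₁ - s * e₂) with h' | h' <;> rw [h']
  · exact ⟨_, isOrientation_eigenBundle H₁ H₂ hs' (neg_ne_zero.mpr hs0), h⟩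
  · refine ⟨_, ?_, h.neg (neg_mem_fiberAt_eigenBundle H₁ H₂)⟩
    convert isOrientation_eigenBundle H₁ H₂ hs' hs0 using 2
    ext
    simp

lemma isEulerSplitting_eigenBundle (hp : IsCoveringMap p) :
    IsEulerSplitting p ρ₁ ρ₂ (eigenBundle H₁ H₂ 1) (eigenBundle H₁ H₂ (-1)) where
  subbundle₁ := isSubbundle_eigenBundle H₁ H₂ (by norm_num)
  subbundle₂ := isSubbundle_eigenBundle H₁ H₂ (by norm_num)
  directSum := eigenBundle_directSum H₁ H₂
  orthogonal x v hv w hw := by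
    rw [mem_fiberAt_eigenBundle] at hv hw
    exact formQ_eq_zero (H₁.isCompatible x) (H₂.isCompatible x) hv hw
  timelike x v hv h0 := by
    rw [mem_fiberAt_eigenBundle] at hv
    simpa using formQ_self_pos (H₁.isCompatible x) (H₂.isCompatible x) (by norm_num) hv h0
  spacelike x v hv h0 := by
    rw [mem_fiberAt_eigenBundle] at hv
    simpa using formQ_self_pos (H₁.isCompatible x) (H₂.isCompatible x) (by norm_num) hv h0
  euler κ e₁ e₂ h₁ h₂ :=
    ⟨by simpa using exists_orientation_eigenBundle H₁ H₂ hp (s := 1) (by norm_num) h₁ h₂,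
      by simpa using exists_orientation_eigenBundle H₁ H₂ hp (s := -1) (by norm_num) h₁ h₂⟩

end TensorSection

/-! ### The real parts of the sums of isotropic lines -/

section RealPartLemmas

lemma complexifyVec_apply (v : Fin 2 → ℝ) (i : Fin 2) : complexifyVec v i = (v i : ℂ) := rfl

lemma complexify_tmul (v w : Fin 2 → ℝ) :
    complexify (v ⊗ₜ w) = complexifyVec v ⊗ₜ[ℂ] complexifyVec w := rfl

lemma complexify_smul (a : ℝ) (z : (Fin 2 → ℝ) ⊗[ℝ] (Fin 2 → ℝ)) :
    complexify (a • z) = (a : ℂ) • complexify z := by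
  induction z with
  | zero => simp
  | add x y hx hy => rw [smul_add, map_add, map_add, smul_add, hx, hy]
  | tmul v w =>
    have : complexifyVec (a • v) = (a : ℂ) • complexifyVec v := by
      ext i; simp [complexifyVec_apply]
    rw [TensorProduct.smul_tmul', complexify_tmul, complexify_tmul, this,
      TensorProduct.smul_tmul']

/-- Coordinates in the product of the standard bases are only reinterpreted as complex numbers. -/
lemma complexify_injective : Function.Injective complexify := by
  let b := (Pi.basisFun ℝ (Fin 2)).tensorProduct (Pi.basisFun ℝ (Fin 2))
  let bc := (Pi.basisFun ℂ (Fin 2)).tensorProduct (Pi.basisFun ℂ (Fin 2))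
  have key : ∀ z i, bc.repr (complexify z) i = (b.repr z i : ℂ) := by
    intro z i
    induction z with
    | zero => simp
    | add x y hx hy => simp [hx, hy]
    | tmul v w =>
      obtain ⟨j, k⟩ := i
      simp [b, bc, complexify_tmul, complexifyVec_apply, Module.Basis.tensorProduct_repr_tmul_apply,
        mul_comm]
  intro x y hxy
  refine b.ext_elem fun i => ?_
  have := key x i
  rw [hxy, key y i] at this
  exact_mod_cast this.symm

variable {X Γ : Type*} [Group Γ] [MulAction Γ X] [TopologicalSpace X] [ChartedSpace ℂ X]

/-- The complexification of the complex structure `Ω⁻¹ H`. -/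
def EquivariantMetric.complexifiedStructure {ρ : Γ →* SL(2, ℝ)} (H : EquivariantMetric X ρ)
    (x : X) : (Fin 2 → ℂ) →ₗ[ℂ] (Fin 2 → ℂ) :=
  Matrix.toLin' ((-volMatrix * H.metric x).map Complex.ofReal)

section

variable {ρ : Γ →* SL(2, ℝ)} (H : EquivariantMetric X ρ) (x : X)

lemma complexifiedStructure_apply (u : Fin 2 → ℂ) :
    H.complexifiedStructure x u = ![-(H.metric x 1 0 * u 0 + H.metric x 1 1 * u 1),
      H.metric x 0 0 * u 0 + H.metric x 0 1 * u 1] := by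
  ext i
  fin_cases i <;>
    simp [EquivariantMetric.complexifiedStructure, volMatrix, Matrix.mulVec, dotProduct,
      Fin.sum_univ_two, Matrix.vecMul]

lemma complexifyVec_complexStructure (v : Fin 2 → ℝ) :
    complexifyVec (H.complexStructure x v) = H.complexifiedStructure x (complexifyVec v) := by
  rw [complexifiedStructure_apply, EquivariantMetric.complexStructure_apply]
  ext i
  fin_cases i <;> simp [complexifyVec_apply]

/-- Multiplying Hu = cΩu by Ω⁻¹ turns it into an eigenvector equation for J. -/
lemma mem_isotropicLine {c : ℂ} {u : Fin 2 → ℂ} :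
    u ∈ isotropicLine (H.metric x) c ↔ H.complexifiedStructure x u = c • u := by
  rw [complexifiedStructure_apply, isotropicLine, LinearMap.mem_ker, LinearMap.sub_apply,
    sub_eq_zero, LinearMap.smul_apply, funext_iff, funext_iff]
  simp only [Fin.forall_fin_two, Matrix.toLin'_apply, Matrix.mulVec, dotProduct,
    Fin.sum_univ_two, Matrix.map_apply, volMatrix, Pi.smul_apply, smul_eq_mul]
  simp
  constructor
  · rintro ⟨h1, h2⟩
    exact ⟨by linear_combination -h2, by linear_combination h1⟩
  · rintro ⟨h1, h2⟩
    exact ⟨by linear_combination h2, by linear_combination -h1⟩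

/-- Since c² = -1, the operator (1 - cJ)/2 is the projection to the eigenline for c. -/
lemma sub_smul_mem_isotropicLine {c : ℂ} (hc : c * c = -1) (v : Fin 2 → ℝ) :
    (2⁻¹ : ℂ) • (complexifyVec v - c • complexifyVec (H.complexStructure x v)) ∈
      isotropicLine (H.metric x) c := by
  rw [mem_isotropicLine, map_smul, map_sub, map_smul, ← complexifyVec_complexStructure,
    ← complexifyVec_complexStructure, (H.isCompatible x).sq, map_neg]
  match_scalars
  · linear_combination 2⁻¹ * hc
  · ring

end

variable {ρ₁ ρ₂ : Γ →* SL(2, ℝ)} (H₁ : EquivariantMetric X ρ₁) (H₂ : EquivariantMetric X ρ₂)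

lemma complexify_map (x : X) (z : (Fin 2 → ℝ) ⊗[ℝ] (Fin 2 → ℝ)) :
    complexify (TensorProduct.map (H₁.complexStructure x) (H₂.complexStructure x) z) =
      TensorProduct.map (H₁.complexifiedStructure x) (H₂.complexifiedStructure x)
        (complexify z) := by
  induction z with
  | zero => simp
  | add a b ha hb => simp only [map_add, ha, hb]
  | tmul v w => simp only [TensorProduct.map_tmul, complexify_tmul, complexifyVec_complexStructure]

lemma map_of_mem_tensorLine {c d : ℂ} {x : X} {u : (Fin 2 → ℂ) ⊗[ℂ] (Fin 2 → ℂ)}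
    (hu : u ∈ tensorLine H₁ H₂ c d x) :
    TensorProduct.map (H₁.complexifiedStructure x) (H₂.complexifiedStructure x) u =
      (c * d) • u := by
  have hle : tensorLine H₁ H₂ c d x ≤ LinearMap.ker
      (TensorProduct.map (H₁.complexifiedStructure x) (H₂.complexifiedStructure x) -
        (c * d) • LinearMap.id) := by
    refine Submodule.map₂_le.mpr fun a ha b hb => ?_
    rw [mem_isotropicLine] at ha hb
    rw [LinearMap.mem_ker, LinearMap.sub_apply, sub_eq_zero, TensorProduct.mk_apply,
      TensorProduct.map_tmul, ha, hb, TensorProduct.smul_tmul_smul]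
    rfl
  have := hle hu
  rwa [LinearMap.mem_ker, LinearMap.sub_apply, sub_eq_zero] at this

/-- In the sum of (1 - iJ₁)/2 ⊗ (1 - dJ₂)/2 and the same product with i, d replaced by -i, -d, the
mixed terms cancel and (1 + id J₁ ⊗ J₂)/2 remains, with id = s. -/
lemma complexify_twistProj_mem {s : ℝ} {d : ℂ} (hd : d * d = -1) (hs : Complex.I * d = s) (x : X)
    (z : (Fin 2 → ℝ) ⊗[ℝ] (Fin 2 → ℝ)) :
    complexify (twistProj (H₁.complexStructure x) (H₂.complexStructure x) s z) ∈
      tensorLine H₁ H₂ Complex.I d x ⊔ tensorLine H₁ H₂ (-Complex.I) (-d) x := by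
  induction z with
  | zero => simp
  | add a b ha hb => rw [map_add, map_add]; exact add_mem ha hb
  | tmul v w =>
    have h₁ := fun c hc => sub_smul_mem_isotropicLine H₁ x (c := c) hc v
    have h₂ := fun c hc => sub_smul_mem_isotropicLine H₂ x (c := c) hc w
    have e₁ := Submodule.apply_mem_map₂ (TensorProduct.mk ℂ _ _)
      (h₁ Complex.I Complex.I_mul_I) (h₂ d hd)
    have e₂ := Submodule.apply_mem_map₂ (TensorProduct.mk ℂ _ _)
      (h₁ (-Complex.I) (by rw [neg_mul_neg, Complex.I_mul_I])) (h₂ (-d) (by rw [neg_mul_neg, hd]))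
    have hsum := Submodule.add_mem_sup e₁ e₂
    simp only [TensorProduct.mk_apply, TensorProduct.sub_tmul, TensorProduct.tmul_sub,
      TensorProduct.tmul_smul, ← TensorProduct.smul_tmul'] at hsum
    refine (congrArg (· ∈ _) ?_).mpr hsum
    rw [twistProj_apply, complexify_smul, map_add, complexify_smul, TensorProduct.map_tmul,
      complexify_tmul, complexify_tmul, ← hs]
    push_cast
    module

lemma complexify_mem_iff {s : ℝ} {d : ℂ} (hss : s * s = 1) (hd : d * d = -1)
    (hs : Complex.I * d = s) (x : X) (z : (Fin 2 → ℝ) ⊗[ℝ] (Fin 2 → ℝ)) :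
    complexify z ∈ tensorLine H₁ H₂ Complex.I d x ⊔ tensorLine H₁ H₂ (-Complex.I) (-d) x ↔
      tensorStructure H₁ H₂ x z = s • z := by
  constructor
  · intro h
    obtain ⟨a, ha, b, hb, hab⟩ := Submodule.mem_sup.mp h
    apply complexify_injective
    rw [tensorStructure, complexify_map, complexify_smul, ← hab, map_add,
      map_of_mem_tensorLine _ _ ha, map_of_mem_tensorLine _ _ hb, neg_mul_neg, hs, ← smul_add]
  · intro h
    rw [← twistProj_of_map_eq hss h]
    exact complexify_twistProj_mem H₁ H₂ hd hs x z

lemma realPart₁_eq : realPart₁ H₁ H₂ = eigenBundle H₁ H₂ 1 := by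
  have := complexify_mem_iff H₁ H₂ (s := 1) (d := -Complex.I) (by norm_num) (by simp) (by simp)
  simp only [neg_neg] at this
  simp only [realPart₁, eigenBundle, this, mem_ofPred_eq]

lemma realPart₂_eq : realPart₂ H₁ H₂ = eigenBundle H₁ H₂ (-1) := by
  have := complexify_mem_iff H₁ H₂ (s := -1) (d := Complex.I) (by norm_num) (by simp) (by simp)
  simp only [realPart₂, eigenBundle, this, mem_ofPred_eq]

end RealPartLemmas

/-! ### Existence of equivariant metrics -/

section Existence

variable {S X Γ : Type*} [Group Γ] [MulAction Γ X]

/-- The group element which moves `x` to the sheet `V`. -/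
def sheetElement (Γ : Type*) [Group Γ] [MulAction Γ X] (V : Set X) (x : X) : Γ :=
  open Classical in if h : ∃ g : Γ, g • x ∈ V then h.choose else 1

/-- Distinct translates of the sheet are disjoint, so the element moving x into it is unique. Hence
the choice is constant on each translate. -/
lemma sheetElement_eq {V : Set X} (hV : ∀ g : Γ, ((g • ·) '' V ∩ V).Nonempty → g = 1) {x : X}
    {g : Γ} (hg : g • x ∈ V) : sheetElement Γ V x = g := by
  have h : ∃ g : Γ, g • x ∈ V := ⟨g, hg⟩
  rw [sheetElement, dif_pos h]
  have := hV (h.choose * g⁻¹) ⟨h.choose • x, ⟨g • x, hg, by simp [mul_smul]⟩, h.choose_spec⟩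
  exact mul_inv_eq_one.mp this

/-- The metric which is standard on the sheet `V`, cut off by `χ`. -/
def sheetMetric (ρ : Γ →* SL(2, ℝ)) (p : X → S) (V : Set X) (χ : S → ℝ) (x : X) :
    Matrix (Fin 2) (Fin 2) ℝ :=
  χ (p x) • ((ρ (sheetElement Γ V x) : Matrix (Fin 2) (Fin 2) ℝ).transpose *
    (ρ (sheetElement Γ V x) : Matrix (Fin 2) (Fin 2) ℝ))

variable {p : X → S} {ρ : Γ →* SL(2, ℝ)} {V : Set X} {χ : S → ℝ}

lemma posDef_sheetMetric {x : X} (hχ : 0 < χ (p x)) : (sheetMetric ρ p V χ x).PosDef := by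
  refine Matrix.PosDef.smul ?_ hχ
  have hdet := (ρ (sheetElement Γ V x)).det_coe
  have := Matrix.PosDef.conjTranspose_mul_self
    (ρ (sheetElement Γ V x) : Matrix (Fin 2) (Fin 2) ℝ)
    (Matrix.mulVec_injective_of_isUnit ((Matrix.isUnit_iff_isUnit_det _).mpr (by rw [hdet]; simp)))
  simpa [Matrix.conjTranspose_eq_transpose_of_trivial] using this

lemma posSemidef_sheetMetric {x : X} (hχ : 0 ≤ χ (p x)) :
    (sheetMetric ρ p V χ x).PosSemidef := by
  rcases hχ.eq_or_lt with h | h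
  · rw [sheetMetric, ← h, zero_smul]
    exact Matrix.PosSemidef.zero
  · exact (posDef_sheetMetric h).posSemidef

variable [TopologicalSpace S] [TopologicalSpace X]

lemma exists_smul_mem (hp : IsQuotientCoveringMap p Γ) {x : X} (hx : p x ∈ p '' V) :
    ∃ g : Γ, g • x ∈ V := by
  obtain ⟨v, hv, hvx⟩ := hx
  obtain ⟨g, rfl⟩ := hp.apply_eq_iff_mem_orbit.mp hvx
  exact ⟨g, hv⟩

lemma sheetMetric_equivariant (hp : IsQuotientCoveringMap p Γ)
    (hV : ∀ g : Γ, ((g • ·) '' V ∩ V).Nonempty → g = 1) (hχ : tsupport χ ⊆ p '' V)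
    (g : Γ) (x : X) : (ρ g : Matrix (Fin 2) (Fin 2) ℝ).transpose *
      sheetMetric ρ p V χ (g • x) * (ρ g : Matrix _ _ ℝ) = sheetMetric ρ p V χ x := by
  simp only [sheetMetric, hp.map_smul]
  by_cases hx : p x ∈ p '' V
  · obtain ⟨k, hk⟩ := exists_smul_mem hp hx
    -- If k moves x into the sheet, then k g⁻¹ does so for g • x; the resulting factor ρ(g) is
    -- absorbed by the equivariance formula.
    have hk' : (k * g⁻¹) • g • x ∈ V := by simpa [mul_smul] using hk
    have hkg : (ρ k : Matrix (Fin 2) (Fin 2) ℝ) = ρ (k * g⁻¹) * ρ g := by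
      rw [← Matrix.SpecialLinearGroup.coe_mul, ← map_mul, inv_mul_cancel_right]
    rw [sheetElement_eq hV hk, sheetElement_eq hV hk', hkg, Matrix.transpose_mul]
    simp only [Matrix.mul_smul, Matrix.smul_mul, Matrix.mul_assoc]
  · rw [image_eq_zero_of_notMem_tsupport fun h => hx (hχ h)]
    simp

variable [ChartedSpace ℂ X]

/-- Over the image of the sheet the group element is locally constant. Elsewhere the point lies off
the closed support of χ, so the metric vanishes nearby. -/
lemma contMDiff_sheetMetric [ChartedSpace ℂ S] (hp : IsQuotientCoveringMap p Γ)
    (hps : ContMDiff 𝓘(ℝ, ℂ) 𝓘(ℝ, ℂ) ∞ p) (hVo : IsOpen V)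
    (hV : ∀ g : Γ, ((g • ·) '' V ∩ V).Nonempty → g = 1) (hχ : tsupport χ ⊆ p '' V)
    (hχs : ContMDiff 𝓘(ℝ, ℂ) 𝓘(ℝ, ℝ) ∞ χ) (i j : Fin 2) :
    ContMDiff 𝓘(ℝ, ℂ) 𝓘(ℝ, ℝ) ∞ fun x => sheetMetric ρ p V χ x i j := by
  intro x
  have := hp.toContinuousConstSMul
  by_cases hx : p x ∈ p '' V
  · obtain ⟨g, hg⟩ := exists_smul_mem hp hx
    have hsm : ContMDiff 𝓘(ℝ, ℂ) 𝓘(ℝ, ℝ) ∞ fun y => χ (p y) *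
        ((ρ g : Matrix (Fin 2) (Fin 2) ℝ).transpose * (ρ g : Matrix (Fin 2) (Fin 2) ℝ)) i j :=
      (hχs.comp hps).mul contMDiff_const
    refine (hsm x).congr_of_eventuallyEq ?_
    filter_upwards [(hVo.preimage (continuous_const_smul g)).mem_nhds hg] with y hy
    rw [sheetMetric, sheetElement_eq hV hy, Matrix.smul_apply, smul_eq_mul]
  · have hx' : x ∈ p ⁻¹' (tsupport χ)ᶜ := fun h => hx (hχ h)
    refine (contMDiff_const (c := (0 : ℝ)) x).congr_of_eventuallyEq ?_
    filter_upwards [((isClosed_tsupport χ).isOpen_compl.preimage hps.continuous).mem_nhds hx']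
      with y hy
    rw [sheetMetric, image_eq_zero_of_notMem_tsupport hy, zero_smul, Matrix.zero_apply]

/-- A metric on a flat plane bundle can be normalized to have area form `ω`. -/
lemma nonempty_equivariantMetric_of_posDef
    (M : X → Matrix (Fin 2) (Fin 2) ℝ)
    (hM : ∀ i j, ContMDiff 𝓘(ℝ, ℂ) 𝓘(ℝ, ℝ) ∞ fun x => M x i j) (hpos : ∀ x, (M x).PosDef)
    (hequiv : ∀ (g : Γ) (x : X),
      (ρ g : Matrix (Fin 2) (Fin 2) ℝ).transpose * M (g • x) * (ρ g : Matrix _ _ ℝ) = M x) :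
    Nonempty (EquivariantMetric X ρ) := by
  have hdet : ∀ x, 0 < (M x).det := fun x => (hpos x).det_pos
  have hdetg : ∀ (g : Γ) x, (M (g • x)).det = (M x).det := fun g x => by
    rw [← hequiv g x]
    simp [Matrix.det_mul]
  refine ⟨⟨fun x => (√(M x).det)⁻¹ • M x, fun i j => ?_, fun x => ?_, fun x => ?_,
    fun g x => ?_⟩⟩
  · have h1 : ContMDiff 𝓘(ℝ, ℂ) 𝓘(ℝ, ℝ) ∞ fun x => (M x).det := by
      simp only [Matrix.det_fin_two]
      exact ((hM 0 0).mul (hM 1 1)).sub ((hM 0 1).mul (hM 1 0))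
    have h2 : ContMDiff 𝓘(ℝ, ℂ) 𝓘(ℝ, ℝ) ∞ fun x => (√(M x).det)⁻¹ := fun x => by
      have : ContDiffAt ℝ ∞ (fun y : ℝ => (√y)⁻¹) (M x).det :=
        (Real.contDiffAt_sqrt (hdet x).ne').inv (Real.sqrt_pos.mpr (hdet x)).ne'
      exact ContMDiffAt.comp (g := fun y : ℝ => (√y)⁻¹) (f := fun x => (M x).det) x
        this.contMDiffAt (h1 x)
    exact h2.mul (hM i j)
  · exact (hpos x).smul (inv_pos.mpr (Real.sqrt_pos.mpr (hdet x)))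
  -- In rank two the determinant scales by the square of the factor, hence the square root.
  · rw [Matrix.det_smul, Fintype.card_fin, inv_pow, Real.sq_sqrt (hdet x).le,
      inv_mul_cancel₀ (hdet x).ne']
  · simp only [hdetg, Matrix.mul_smul, Matrix.smul_mul, hequiv]

/-- Flat plane bundles over closed surfaces admit metrics. -/
theorem nonempty_equivariantMetric [T2Space S] [CompactSpace S] [ChartedSpace ℂ S]
    [IsManifold 𝓘(ℝ, ℂ) ∞ S] (hp : IsQuotientCoveringMap p Γ)
    (hps : ContMDiff 𝓘(ℝ, ℂ) 𝓘(ℝ, ℂ) ∞ p) (ρ : Γ →* SL(2, ℝ)) :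
    Nonempty (EquivariantMetric X ρ) := by
  have hloc : ∀ z : S, ∃ (V : Set X) (χ : S → ℝ), IsOpen V ∧
      (∀ g : Γ, ((g • ·) '' V ∩ V).Nonempty → g = 1) ∧ tsupport χ ⊆ p '' V ∧
      ContMDiff 𝓘(ℝ, ℂ) 𝓘(ℝ, ℝ) ∞ χ ∧ (∀ y, 0 ≤ χ y) ∧ Function.support χ ∈ 𝓝 z := by
    intro z
    obtain ⟨x, rfl⟩ := hp.surjective z
    obtain ⟨U, hU, hdisj⟩ := hp.disjoint x
    have hmem : p '' interior U ∈ 𝓝 (p x) :=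
      (hp.isOpenQuotientMap.isOpenMap _ isOpen_interior).mem_nhds
        ⟨x, mem_interior_iff_mem_nhds.mpr hU, rfl⟩
    -- The closed support must lie in the image of the sheet, so that extension by zero is smooth.
    obtain ⟨f, -, hf⟩ := (SmoothBumpFunction.nhds_basis_tsupport (I := 𝓘(ℝ, ℂ)) (p x)).mem_iff.mp
      hmem
    exact ⟨interior U, f, isOpen_interior, fun g hg => hdisj g (hg.mono (inter_subset_inter
      (image_mono interior_subset) interior_subset)), hf, f.contMDiff, fun y => f.nonneg,
      f.support_mem_nhds⟩
  choose V χ hVo hV hχ hχs hχ0 hsupp using hloc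
  obtain ⟨t, -, ht⟩ := isCompact_univ.elim_nhds_subcover _ fun z _ => hsupp z
  refine nonempty_equivariantMetric_of_posDef
    (fun x => ∑ z ∈ t, sheetMetric ρ p (V z) (χ z) x) (fun i j => ?_) (fun x => ?_) fun g x => ?_
  · simp only [Matrix.sum_apply]
    exact contMDiff_finsetSum fun z _ =>
      contMDiff_sheetMetric hp hps (hVo z) (hV z) (hχ z) (hχs z) i j
  -- By the covering property some summand is positive definite at x; the others are at least
  -- semidefinite.
  · obtain ⟨z, hz, hxz⟩ := mem_iUnion₂.mp (ht (mem_univ (p x)))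
    classical
    rw [← Finset.add_sum_erase t _ hz]
    exact (posDef_sheetMetric ((hχ0 z _).lt_of_ne' hxz)).add_posSemidef
      (Matrix.posSemidef_sum _ fun y _ => posSemidef_sheetMetric (hχ0 y _))
  · rw [Finset.mul_sum, Finset.sum_mul]
    exact Finset.sum_congr rfl fun z _ => sheetMetric_equivariant hp (hV z) (hχ z) g x

end Existence

end

/-! ### The proposition -/

theorem mainTheorem9
    {S X Γ : Type*}
    [TopologicalSpace S] [T2Space S] [CompactSpace S]
    [ChartedSpace ℂ S] [IsManifold 𝓘(ℝ, ℂ) ∞ S] (hS : IsOrientedAtlas S)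
    [TopologicalSpace X] [SimplyConnectedSpace X]
    [ChartedSpace ℂ X] [IsManifold 𝓘(ℝ, ℂ) ∞ X]
    [Group Γ] [MulAction Γ X]
    (p : X → S) (hp : IsQuotientCoveringMap p Γ)
    (hploc : IsLocalDiffeomorph 𝓘(ℝ, ℂ) 𝓘(ℝ, ℂ) ∞ p)
    (ρ₁ ρ₂ : Γ →* SL(2, ℝ)) :
    (∃ F₁ F₂ : Set (FlatBundle X (tensorRep ρ₁ ρ₂)), IsEulerSplitting p ρ₁ ρ₂ F₁ F₂) ∧
    ∀ (H₁ : EquivariantMetric X ρ₁) (H₂ : EquivariantMetric X ρ₂),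
      IsEulerSplitting p ρ₁ ρ₂ (realPart₁ H₁ H₂) (realPart₂ H₁ H₂) := by
  obtain ⟨K₁⟩ := nonempty_equivariantMetric hp hploc.contMDiff ρ₁
  obtain ⟨K₂⟩ := nonempty_equivariantMetric hp hploc.contMDiff ρ₂
  refine ⟨⟨_, _, isEulerSplitting_eigenBundle K₁ K₂ hp.isCoveringMap⟩, fun H₁ H₂ => ?_⟩
  rw [realPart₁_eq, realPart₂_eq]
  exact isEulerSplitting_eigenBundle H₁ H₂ hp.isCoveringMap
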